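/- Setting. For each number of assets $N$ and periods $T$ (all features of the data-generating process, apart from the fixed quantities $\lambda,\Sigma_F,\Omega_F,\Gamma,\Sigma_{SF^2}$, may change with $N,T$), one observes excess returns $r_{it}$, $i\le N$, $t\le T$, and a $k_F$-vector of factors $F_t=(F_{t,1}',F_{t,2}')'$ with blocks of sizes $k_1$ and $k_2$, $k_F=k_1+k_2$, $k_2\ge 1$ (there are weak observed factors), satisfying the factor-pricing model without missing factors ($k_v=0$) $$r_{it}=\lambda'\beta_i+(F_t-EF_t)'\beta_i+e_{it},$$ with non-random exposures $\beta_i=(\beta_{i,1}',\beta_{i,2}')'$. Write $\widetilde F_t=F_t-\frac1T\sum_{s=1}^T F_s$ and $\gamma_i=(\beta_{i,1}',\sqrt T\beta_{i,2}')'$. Limits are taken as both $N$ and $T$ increase to infinity, with no restriction on their relative rates. Assume: * FACTORS. $F_t$ is stationary with finite fourth moments and full-rank covariance matrix $\Sigma_F$; $\frac1{\sqrt T}\sum_{t=1}^T(F_t-EF_t)\Rightarrow N(0,\Omega_F)$; and $\frac1T\sum_{t=1}^T\widetilde F_t\widetilde F_t'\to^p\Sigma_F$. * LOADINGS. $\frac1N\sum_{i=1}^N\gamma_i\gamma_i'\to\Gamma$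 with $\Gamma$ positive definite, and $\sup_{N,T}\frac1N\sum_{i=1}^N\|\gamma_i\|^4<\infty$. * ERRORS. (i) Conditional on $\mathcal F=\sigma(F_1,\dots,F_T)$ the vectors $e_t=(e_{1t},\dots,e_{Nt})'$, $t\le T$, are independent, and $E(e_t|\mathcal F)=0$. (ii) With $\rho(t,s)=\frac1{\sqrt N}\sum_{i=1}^N e_{it}e_{is}$, there is a constant $C$, not depending on $N,T$, with $\sup_t\sup_{s\ne t}E[(1+\|F_t\|^4)(\rho(s,t)^2+1)]<C$. (iii) With $S_t=\frac1N\sum_{i=1}^N e_{it}^2$, $\frac{\sqrt N}{T}\sum_{t=1}^T\widetilde F_tS_t=o_p(1)$ and $\frac1T\sum_{t=1}^T\widetilde F_t\widetilde F_t'S_t\to^p\Sigma_{SF^2}$. (iv) With $W_t=\frac1{\sqrt N}\sum_{i=1}^N\gamma_ie_{it}$, $E[(1+\|F_t\|^2)\|W_t\|^2]$ is bounded uniformly in $t,N,T$. Let $\widehat\beta_i=\big(\sum_t\widetilde F_t\widetilde F_t'\big)^{-1}\sum_t\widetilde F_tr_{it}$ be the first-pass estimates, $\widehat\lambda_{TP}=\big(\sum_i\widehat\beta_i\widehat\beta_i'\big)^{-1}\sum_i\widehat\beta_i\,\frac1T\sum_tr_{it}$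 the two-pass estimate, $\widetilde\lambda=\lambda+\frac1T\sum_tF_t-EF_t$, $u_i=\frac1T\sum_t\Sigma_F^{-1}\widetilde F_te_{it}$, and $$B^A=-\Big(\sum_{i=1}^N\widehat\beta_i\widehat\beta_i'\Big)^{-1}\sum_{i=1}^Nu_iu_i'\widetilde\lambda .$$ Let $\Sigma_u=\Sigma_F^{-1}\Sigma_{SF^2}\Sigma_F^{-1}$ and let $\mathcal I_{k_2}$ be the $k_F\times k_F$ block matrix with $I_{k_2}$ in the last diagonal block and zeros elsewhere. Subscripts $1,2$ on $k_F$-vectors denote the first $k_1$ and the last $k_2$ components. Conclusion. Jointly, $$\sqrt T(\widehat\lambda_{TP,1}-\lambda_1)=\sqrt T(\widetilde\lambda_1-\lambda_1)+\sqrt T B^A_1+o_p(1),\qquad \widehat\lambda_{TP,2}-\lambda_2=B^A_2+o_p(1),$$ the matrix $\Gamma+\mathcal I_{k_2}\Sigma_u\mathcal I_{k_2}$ is invertible, and $$\begin{pmatrix}\sqrt T B^A_1\\ B^A_2\end{pmatrix}\to^p-\big(\Gamma+\mathcal I_{k_2}\Sigma_u\mathcal I_{k_2}\big)^{-1}\mathcal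 I_{k_2}\Sigma_u\lambda .$$ This limit is a non-random vector, and it is non-zero whenever $\mathcal I_{k_2}\Sigma_u\lambda\ne0$. -/

import Mathlib

open MeasureTheory ProbabilityTheory Filter Topology Matrix

noncomputable section

namespace TwoPass

/-- Index set of the `k₁ + k₂` observed factors: the first block is the strong factors,
the second block the weak ones. -/
abbrev Fac (k₁ k₂ : ℕ) : Type := Fin k₁ ⊕ Fin k₂

/-- The squared Euclidean norm. -/
def sqNorm {ι : Type*} [Fintype ι] (x : ι → ℝ) : ℝ := ∑ a, x a ^ 2

/-- Convergence in probability to a constant, as `N` and `T` both tend to infinity with no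
restriction on their relative rates, for a double array of random elements that may live on
different probability spaces. `o_p(1)` is the case `c = 0`. -/
def TendstoInProb {Ω : ℕ → ℕ → Type*} [∀ N T, MeasurableSpace (Ω N T)]
    (P : ∀ N T, Measure (Ω N T)) {E : Type*} [PseudoMetricSpace E]
    (X : ∀ N T, Ω N T → E) (c : E) : Prop :=
  ∀ ε : ℝ, 0 < ε →
    Tendsto (fun p : ℕ × ℕ => P p.1 p.2 {ω | ε ≤ dist (X p.1 p.2 ω) c})
      (atTop ×ˢ atTop) (𝓝 0)

/-- Conditional (mutual) independence of a family of random elements given a σ-algebra `m`.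
(No assumption is made on the underlying probability space.) -/
def CondIndepFamily {Ω : Type*} (m : MeasurableSpace Ω) {mΩ : MeasurableSpace Ω} {ι E : Type*}
    [MeasurableSpace E] (P : Measure Ω) (X : ι → Ω → E) : Prop :=
  ∀ (S : Finset ι) (A : ι → Set E), (∀ t ∈ S, MeasurableSet (A t)) →
    P⟦⋂ t ∈ S, X t ⁻¹' A t | m⟧ =ᵐ[P] ∏ t ∈ S, P⟦X t ⁻¹' A t | m⟧

/-- A data-generating process with `N` assets and `T` periods. Period `t = 1, …, T` of the sample
corresponds to index `t - 1`; the factor process is indexed by all of `ℕ`. -/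
structure Panel (k₁ k₂ N T : ℕ) (Ω : Type*) where
  /-- observed factors `F_t` -/
  F : ℕ → Ω → Fac k₁ k₂ → ℝ
  /-- excess returns `r_{it}` -/
  r : Fin N → Fin T → Ω → ℝ
  /-- idiosyncratic errors `e_{it}` -/
  e : Fin N → Fin T → Ω → ℝ
  /-- (non-random) risk exposures `β_i` -/
  β : Fin N → Fac k₁ k₂ → ℝ

namespace Panel

variable {k₁ k₂ N T : ℕ} {Ω : Type*} (D : Panel k₁ k₂ N T Ω)

/-- `E F_t` -/
def meanF [MeasurableSpace Ω] (P : Measure Ω) (t : ℕ) : Fac k₁ k₂ → ℝ :=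
  fun a => ∫ ω, D.F t ω a ∂P

/-- The time average of the observed factors. -/
def avgF (ω : Ω) : Fac k₁ k₂ → ℝ := (T : ℝ)⁻¹ • ∑ t : Fin T, D.F t ω

/-- The demeaned factors. -/
def Ftilde (t : Fin T) (ω : Ω) : Fac k₁ k₂ → ℝ := D.F t ω - D.avgF ω

/-- First-pass estimate: the slope of the time-series OLS regression of `r_{it}` on a constant
and `F_t`. -/
def betaHat (i : Fin N) (ω : Ω) : Fac k₁ k₂ → ℝ :=
  (∑ t, vecMulVec (D.Ftilde t ω) (D.Ftilde t ω))⁻¹ *ᵥ ∑ t, D.r i t ω • D.Ftilde t ω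

/-- Time-average excess return of asset `i`. -/
def avgR (i : Fin N) (ω : Ω) : ℝ := (T : ℝ)⁻¹ * ∑ t, D.r i t ω

/-- `∑ᵢ β̂ᵢ β̂ᵢ'` -/
def gram (ω : Ω) : Matrix (Fac k₁ k₂) (Fac k₁ k₂) ℝ :=
  ∑ i, vecMulVec (D.betaHat i ω) (D.betaHat i ω)

/-- The two-pass estimate: OLS regression of the average returns on the first-pass estimates. -/
def lamTP (ω : Ω) : Fac k₁ k₂ → ℝ :=
  (D.gram ω)⁻¹ *ᵥ ∑ i, D.avgR i ω • D.betaHat i ω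

/-- Ex-post risk premia. -/
def lamTilde [MeasurableSpace Ω] (P : Measure Ω) (lam : Fac k₁ k₂ → ℝ) (ω : Ω) :
    Fac k₁ k₂ → ℝ :=
  lam + (T : ℝ)⁻¹ • ∑ t : Fin T, (D.F t ω - D.meanF P t)

/-- `uᵢ = T⁻¹ ∑ₜ Σ_F⁻¹ F̃ₜ eᵢₜ` -/
def u (SigF : Matrix (Fac k₁ k₂) (Fac k₁ k₂) ℝ) (i : Fin N) (ω : Ω) : Fac k₁ k₂ → ℝ :=
  (T : ℝ)⁻¹ • ∑ t, D.e i t ω • (SigF⁻¹ *ᵥ D.Ftilde t ω)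

/-- The attenuation bias `B^A`. -/
def attBias [MeasurableSpace Ω] (P : Measure Ω) (SigF : Matrix (Fac k₁ k₂) (Fac k₁ k₂) ℝ)
    (lam : Fac k₁ k₂ → ℝ) (ω : Ω) : Fac k₁ k₂ → ℝ :=
  -((D.gram ω)⁻¹ *ᵥ
    ((∑ i, vecMulVec (D.u SigF i ω) (D.u SigF i ω)) *ᵥ D.lamTilde P lam ω))

/-- Normalized loadings `γᵢ = (β_{i,1}, √T β_{i,2})`. -/
def γ (i : Fin N) : Fac k₁ k₂ → ℝ :=
  Sum.elim (fun a => D.β i (Sum.inl a)) (fun a => √(T : ℝ) * D.β i (Sum.inr a))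

/-- The σ-algebra generated by `F_1, …, F_T`. -/
abbrev factorSigma : MeasurableSpace Ω :=
  ⨆ t : Fin T, MeasurableSpace.comap (D.F t) inferInstance

/-- `ρ(t,s)` -/
def rho (t s : Fin T) (ω : Ω) : ℝ := (√(N : ℝ))⁻¹ * ∑ i, D.e i t ω * D.e i s ω

/-- `S_t` -/
def S (t : Fin T) (ω : Ω) : ℝ := (N : ℝ)⁻¹ * ∑ i, D.e i t ω ^ 2

/-- `W_t` -/
def W (t : Fin T) (ω : Ω) : Fac k₁ k₂ → ℝ := (√(N : ℝ))⁻¹ • ∑ i, D.e i t ω • D.γ i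

/-- The factor-pricing model without missing factors:
`r_{it} = λ'βᵢ + (F_t - E F_t)'βᵢ + e_{it}` almost surely. -/
def PricingModel [MeasurableSpace Ω] (P : Measure Ω) (lam : Fac k₁ k₂ → ℝ) : Prop :=
  ∀ i t, ∀ᵐ ω ∂P,
    D.r i t ω = lam ⬝ᵥ D.β i + (D.F t ω - D.meanF P t) ⬝ᵥ D.β i + D.e i t ω

end Panel

section Assumptions

variable {k₁ k₂ : ℕ} {Ω : ℕ → ℕ → Type*} [∀ N T, MeasurableSpace (Ω N T)]
  (P : ∀ N T, Measure (Ω N T)) [∀ N T, IsProbabilityMeasure (P N T)]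
  (D : ∀ N T, Panel k₁ k₂ N T (Ω N T))

/-- The observed factors: strictly stationary, with finite fourth moments and full-rank covariance
matrix `SigF`; the central limit theorem for the sample mean and consistency of the sample
covariance matrix hold. -/
structure Factors (SigF OmF : Matrix (Fac k₁ k₂) (Fac k₁ k₂) ℝ) : Prop where
  measurable : ∀ N T t, Measurable ((D N T).F t)
  stationary : ∀ N T,
    IdentDistrib (fun ω t => (D N T).F (t + 1) ω) (fun ω t => (D N T).F t ω) (P N T) (P N T)
  fourth_moment : ∀ N T t, Integrable (fun ω => sqNorm ((D N T).F t ω) ^ 2) (P N T)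
  cov_eq : ∀ N T t a b,
    cov[fun ω => (D N T).F t ω a, fun ω => (D N T).F t ω b; P N T] = SigF a b
  full_rank : SigF.det ≠ 0
  posSemidef : OmF.PosSemidef
  clt : TendstoInDistribution
    (fun (p : ℕ × ℕ) (ω : Ω p.1 p.2) => WithLp.toLp 2
      ((√(p.2 : ℝ))⁻¹ • ∑ t : Fin p.2, ((D p.1 p.2).F t ω - (D p.1 p.2).meanF (P p.1 p.2) t)))
    (atTop ×ˢ atTop) (id : EuclideanSpace ℝ (Fac k₁ k₂) → EuclideanSpace ℝ (Fac k₁ k₂))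
    (fun p => P p.1 p.2) (multivariateGaussian 0 OmF)
  sample_cov : ∀ a b, TendstoInProb P
    (fun N T ω => (T : ℝ)⁻¹ * ∑ t : Fin T, (D N T).Ftilde t ω a * (D N T).Ftilde t ω b) (SigF a b)

/-- The loadings: `N⁻¹ ∑ᵢ γᵢ γᵢ' → Γ`, positive definite, with bounded average fourth powers. -/
structure Loadings (Γ : Matrix (Fac k₁ k₂) (Fac k₁ k₂) ℝ) : Prop where
  posDef : Γ.PosDef
  tendsto : Tendsto
    (fun p : ℕ × ℕ => (p.1 : ℝ)⁻¹ • ∑ i, vecMulVec ((D p.1 p.2).γ i) ((D p.1 p.2).γ i))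
    (atTop ×ˢ atTop) (𝓝 Γ)
  bounded : ∃ C : ℝ, ∀ N T : ℕ, (N : ℝ)⁻¹ * ∑ i, sqNorm ((D N T).γ i) ^ 2 ≤ C

/-- The idiosyncratic errors. All moment bounds are uniform in `N`, `T` and in time. -/
structure Errors (SigSF : Matrix (Fac k₁ k₂) (Fac k₁ k₂) ℝ) : Prop where
  measurable : ∀ N T i t, Measurable ((D N T).e i t)
  integrable : ∀ N T i t, Integrable ((D N T).e i t) (P N T)
  cond_indep : ∀ N T,
    CondIndepFamily (D N T).factorSigma (P N T) (fun t ω i => (D N T).e i t ω)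
  cond_mean : ∀ N T i t, (P N T)[(D N T).e i t | (D N T).factorSigma] =ᵐ[P N T] 0
  rho_bound : ∃ C : ℝ, ∀ N T (t s : Fin T), s ≠ t →
    Integrable (fun ω => (1 + sqNorm ((D N T).F t ω) ^ 2) * ((D N T).rho s t ω ^ 2 + 1)) (P N T) ∧
    ∫ ω, (1 + sqNorm ((D N T).F t ω) ^ 2) * ((D N T).rho s t ω ^ 2 + 1) ∂(P N T) < C
  FS : TendstoInProb P
    (fun N T ω => (√(N : ℝ) / T) • ∑ t, (D N T).S t ω • (D N T).Ftilde t ω) 0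
  FFS : ∀ a b, TendstoInProb P
    (fun N T ω =>
      (T : ℝ)⁻¹ * ∑ t, (D N T).Ftilde t ω a * (D N T).Ftilde t ω b * (D N T).S t ω) (SigSF a b)
  W_bound : ∃ C : ℝ, ∀ N T (t : Fin T),
    Integrable (fun ω => (1 + sqNorm ((D N T).F t ω)) * sqNorm ((D N T).W t ω)) (P N T) ∧
    ∫ ω, (1 + sqNorm ((D N T).F t ω)) * sqNorm ((D N T).W t ω) ∂(P N T) ≤ C

end Assumptions

/-- The matrix `𝓘_{k₂}`: the identity on the weak block and zero elsewhere. -/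
def weakBlock (k₁ k₂ : ℕ) : Matrix (Fac k₁ k₂) (Fac k₁ k₂) ℝ := Matrix.fromBlocks 0 0 0 1

/-- `Σ_u = Σ_F⁻¹ Σ_{SF²} Σ_F⁻¹` -/
def sigmaU {k₁ k₂ : ℕ} (SigF SigSF : Matrix (Fac k₁ k₂) (Fac k₁ k₂) ℝ) :
    Matrix (Fac k₁ k₂) (Fac k₁ k₂) ℝ := SigF⁻¹ * SigSF * SigF⁻¹

/-- `Γ + 𝓘_{k₂} Σ_u 𝓘_{k₂}` -/
def limitGram {k₁ k₂ : ℕ} (Γ Su : Matrix (Fac k₁ k₂) (Fac k₁ k₂) ℝ) :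
    Matrix (Fac k₁ k₂) (Fac k₁ k₂) ℝ := Γ + weakBlock k₁ k₂ * Su * weakBlock k₁ k₂

/-- `-(Γ + 𝓘_{k₂} Σ_u 𝓘_{k₂})⁻¹ 𝓘_{k₂} Σ_u λ` -/
def limitBias {k₁ k₂ : ℕ} (Γ Su : Matrix (Fac k₁ k₂) (Fac k₁ k₂) ℝ) (lam : Fac k₁ k₂ → ℝ) :
    Fac k₁ k₂ → ℝ :=
  -((limitGram Γ Su)⁻¹ *ᵥ (weakBlock k₁ k₂ *ᵥ (Su *ᵥ lam)))

end TwoPass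

end

/-! The second pass regresses on exposures measured with error. Once the sample covariance matrix Ŝ
of the factors is invertible, β̂ᵢ = βᵢ + T^(-1/2) Ŝ⁻¹ `errVec`ᵢ. Multiplying the weak block by √T
turns βᵢ into γᵢ and the noise into `errScale` Ŝ⁻¹ `errVec`ᵢ, which carries a factor T^(-1/2) in the
strong block but none in the weak block, where it is as large as the signal
(`loadScale_mulVec_betaHat`).

Everything reduces to three kinds of cross-sectional averages: noise with noise tends to Σ_{SF²};
loadings with noise, and noise with the time-averaged error scaled by √T, tend to 0. A product of
two time sums splits into its diagonal t = s, controlled by the assumptions on S_t, and an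
off-diagonal part equal, up to demeaning, to N^(-1/2) times `crossSum`. Given the factors, errors of
different periods are independent with mean zero, so summands of `crossSum` belonging to different
unordered pairs of periods are orthogonal. Its second moment is therefore bounded, and dividing by
√N removes it whatever the rate of T (`RegularErrors.integral_crossSum_sq_le`). The loadings are
handled in the same way (`RegularErrors.integral_loadSum_sq_le`).

Hence the normalized Gram matrix tends to Γ + 𝓘Σ_u𝓘, positive definite because Γ is and Σ_u is
positive semidefinite. The average return equals λ̃'β̂ᵢ plus the average error minus λ̃' times the
noise in β̂ᵢ; after regression on β̂ᵢ only the covariance of the noise with itself survives. The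
attenuation bias has the same limit, so the expansions follow by subtracting two equal limits; in
the weak block the central limit theorem also gives λ̃ → λ.

Convergence in probability is expressed as convergence along a filter, so the ordinary calculus of
limits applies. Only monotonicity and subadditivity of probability enter the filter axioms, so
events need not be measurable. -/

noncomputable section

namespace TwoPass

/-! ### Convergence in probability as convergence along a filter -/

section ProbFilter

variable {Ω : ℕ → ℕ → Type*} [∀ N T, MeasurableSpace (Ω N T)] (P : ∀ N T, Measure (Ω N T))

/-- The filter of events of a double array whose probability tends to one: convergence in
probability is convergence along this filter. -/
def probFilter : Filter (Σ p : ℕ × ℕ, Ω p.1 p.2) where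
  sets := {s | Tendsto (fun p : ℕ × ℕ => P p.1 p.2 {ω | (⟨p, ω⟩ : Σ p : ℕ × ℕ, Ω p.1 p.2) ∉ s})
    (atTop ×ˢ atTop) (𝓝 0)}
  univ_sets := by simp
  sets_of_superset := fun {s t} hs hst =>
    tendsto_of_tendsto_of_tendsto_of_le_of_le tendsto_const_nhds hs (fun _ => zero_le)
      fun p => measure_mono fun ω h h' => h (hst h')
  inter_sets := fun {s t} hs ht => by
    have h := Tendsto.add hs ht
    rw [add_zero] at h
    refine tendsto_of_tendsto_of_tendsto_of_le_of_le tendsto_const_nhds h (fun _ => zero_le)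
      fun p => (measure_mono fun ω h => ?_).trans (measure_union_le _ _)
    by_cases hs : (⟨p, ω⟩ : Σ p : ℕ × ℕ, Ω p.1 p.2) ∈ s
    · exact Or.inr fun ht => h ⟨hs, ht⟩
    · exact Or.inl hs

variable {P}

lemma eventually_probFilter {s : (Σ p : ℕ × ℕ, Ω p.1 p.2) → Prop} :
    (∀ᶠ x in probFilter P, s x) ↔
      Tendsto (fun p : ℕ × ℕ => P p.1 p.2 {ω | ¬ s ⟨p, ω⟩}) (atTop ×ˢ atTop) (𝓝 0) := Iff.rfl

lemma eventually_probFilter_of_ae {s : (Σ p : ℕ × ℕ, Ω p.1 p.2) → Prop}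
    (h : ∀ p : ℕ × ℕ, ∀ᵐ ω ∂P p.1 p.2, s ⟨p, ω⟩) : ∀ᶠ x in probFilter P, s x := by
  rw [eventually_probFilter]
  have : (fun p : ℕ × ℕ => P p.1 p.2 {ω | ¬ s ⟨p, ω⟩}) = fun _ => 0 := by
    ext p; exact ae_iff.mp (h p)
  rw [this]; exact tendsto_const_nhds

variable (P) in
lemma tendsto_fst_probFilter :
    Tendsto (fun x : Σ p : ℕ × ℕ, Ω p.1 p.2 => x.1) (probFilter P) (atTop ×ˢ atTop) := by
  intro s hs
  change Tendsto _ _ _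
  refine tendsto_const_nhds.congr' ?_
  filter_upwards [hs] with p hp
  simp [hp]

lemma tendstoInProb_iff {E : Type*} [PseudoMetricSpace E] {X : ∀ N T, Ω N T → E} {c : E} :
    TendstoInProb P X c ↔
      Tendsto (fun x : Σ p : ℕ × ℕ, Ω p.1 p.2 => X x.1.1 x.1.2 x.2) (probFilter P) (𝓝 c) := by
  simp only [TendstoInProb, Metric.tendsto_nhds, eventually_probFilter, not_lt, gt_iff_lt]

/-- Needed to identify limits uniquely and to pass inequalities to the limit, as in
`Errors.posSemidef`. -/
instance [∀ N T, IsProbabilityMeasure (P N T)] : (probFilter P).NeBot := by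
  refine ⟨fun h => ?_⟩
  have : ∀ᶠ x in probFilter P, False := by simp [h]
  rw [eventually_probFilter] at this
  simp only [not_false_eq_true, Set.ofPred_true, measure_univ] at this
  exact one_ne_zero (tendsto_nhds_unique tendsto_const_nhds this)

/-- Chebyshev's inequality: convergence in mean square implies convergence in probability. -/
lemma tendsto_zero_of_integral_sq {X : ∀ N T, Ω N T → ℝ} {c : ℕ × ℕ → ℝ}
    (hc : Tendsto c (atTop ×ˢ atTop) (𝓝 0))
    (hX : ∀ᶠ p : ℕ × ℕ in atTop ×ˢ atTop, Integrable (fun ω => X p.1 p.2 ω ^ 2) (P p.1 p.2) ∧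
      ∫ ω, X p.1 p.2 ω ^ 2 ∂(P p.1 p.2) ≤ c p) :
    Tendsto (fun x : Σ p : ℕ × ℕ, Ω p.1 p.2 => X x.1.1 x.1.2 x.2) (probFilter P) (𝓝 0) := by
  rw [← tendstoInProb_iff]
  intro ε hε
  have h2 : Tendsto (fun p => ENNReal.ofReal (c p / ε ^ 2)) (atTop ×ˢ atTop) (𝓝 0) := by
    have := ENNReal.tendsto_ofReal (hc.div_const (ε ^ 2))
    simpa using this
  refine tendsto_of_tendsto_of_tendsto_of_le_of_le' tendsto_const_nhds h2
    (Eventually.of_forall fun _ => zero_le) ?_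
  filter_upwards [hX] with p ⟨hi, hle⟩
  have hm : P p.1 p.2 {ω | ε ≤ dist (X p.1 p.2 ω) 0}
      ≤ P p.1 p.2 {ω | ENNReal.ofReal (ε ^ 2) ≤ ENNReal.ofReal (X p.1 p.2 ω ^ 2)} := by
    refine measure_mono fun ω h => ENNReal.ofReal_le_ofReal ?_
    simp only [Set.mem_ofPred_eq, dist_zero_right, Real.norm_eq_abs] at h
    rw [← sq_abs (X p.1 p.2 ω)]
    gcongr
  refine hm.trans ((meas_ge_le_lintegral_div hi.1.aemeasurable.ennreal_ofReal
    (by simpa using hε.ne') ENNReal.ofReal_ne_top).trans ?_)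
  rw [← ofReal_integral_eq_lintegral_ofReal hi (ae_of_all _ fun _ => sq_nonneg _),
    ← ENNReal.ofReal_div_of_pos (by positivity)]
  gcongr

/-- A sequence converging in distribution is tight: divided by a diverging scale, it converges
to zero in probability. -/
lemma tendsto_smul_zero_of_tendstoInDistribution [∀ N T, IsProbabilityMeasure (P N T)]
    {E Ω' : Type*} [NormedAddCommGroup E] [NormedSpace ℝ E] [MeasurableSpace E] [BorelSpace E]
    {mΩ' : MeasurableSpace Ω'} {μ : Measure Ω'} [IsProbabilityMeasure μ]
    {X : ∀ p : ℕ × ℕ, Ω p.1 p.2 → E} {Z : Ω' → E}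
    (h : TendstoInDistribution X (atTop ×ˢ atTop) Z (fun p => P p.1 p.2) μ)
    {a : ℕ × ℕ → ℝ} (ha : Tendsto a (atTop ×ˢ atTop) (𝓝 0)) :
    Tendsto (fun x : Σ p : ℕ × ℕ, Ω p.1 p.2 => a x.1 • X x.1 x.2) (probFilter P) (𝓝 0) := by
  rw [Metric.tendsto_nhds]
  intro ε hε
  rw [eventually_probFilter, ENNReal.tendsto_nhds_zero]
  intro δ hδ
  set ν := μ.map Z
  have hν : IsProbabilityMeasure ν := Measure.isProbabilityMeasure_map h.aemeasurable_limit
  have htail : Tendsto (fun n : ℕ => ν {z | (n : ℝ) ≤ ‖z‖}) atTop (𝓝 0) := by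
    have hinter : (⋂ n : ℕ, {z : E | (n : ℝ) ≤ ‖z‖}) = ∅ := by
      ext z
      simp only [Set.mem_iInter, Set.mem_ofPred_eq, Set.mem_empty_iff_false, iff_false, not_forall,
        not_le]
      exact exists_nat_gt _
    rw [← measure_empty (μ := ν), ← hinter]
    refine tendsto_measure_iInter_atTop
      (fun n => (measurableSet_le measurable_const measurable_norm).nullMeasurableSet)
      (fun n m hnm z hz => ?_) ⟨0, measure_ne_top _ _⟩
    exact (Nat.cast_le.mpr hnm).trans (show (m : ℝ) ≤ ‖z‖ from hz)
  -- The level n makes the tail of the limit law smaller than δ. The portmanteau bound for closed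
  -- sets transfers this to X, and eventually |a| n < ε.
  obtain ⟨n, hn⟩ := (htail.eventually (gt_mem_nhds hδ)).exists
  have hcl : IsClosed {z : E | (n : ℝ) ≤ ‖z‖} := isClosed_le continuous_const continuous_norm
  have hls := (ProbabilityMeasure.limsup_measure_closed_le_of_tendsto h.tendsto hcl).trans_lt hn
  have hev := eventually_lt_of_limsup_lt hls
  have ha' : ∀ᶠ p in atTop ×ˢ atTop, |a p| * n < ε := by
    have := (ha.abs.mul_const (n : ℝ))
    simp only [abs_zero, zero_mul] at this
    exact this.eventually (gt_mem_nhds hε)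
  filter_upwards [hev, ha'] with p hp hap
  refine le_trans (measure_mono fun ω hω => ?_)
    ((Measure.le_map_apply (h.forall_aemeasurable p) _).trans hp.le)
  simp only [dist_zero_right, not_lt, Set.mem_ofPred_eq, norm_smul, Real.norm_eq_abs] at hω
  change (n : ℝ) ≤ ‖X p ω‖
  by_contra! hlt
  have := mul_le_mul_of_nonneg_left hlt.le (abs_nonneg (a p))
  linarith

end ProbFilter

/-! ### Orthogonality from conditional independence -/

section CondIndep

variable {Ω : Type*} {m : MeasurableSpace Ω} {mΩ : MeasurableSpace Ω} {ι E : Type*}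
    [MeasurableSpace E] {P : Measure Ω} [IsProbabilityMeasure P] {X : ι → Ω → E}

/-- Conditional independence allows the indicator of the event about the other members to be
replaced by its conditional probability φ given `m`. Since φ is `m`-measurable, it factors out of
the conditional expectation, leaving E[f(X_t) | m] = 0. -/
lemma CondIndepFamily.setIntegral_comp_eq_zero (hX : CondIndepFamily m P X) (hm : m ≤ mΩ)
    (hmeas : ∀ t, Measurable (X t)) {t : ι} {f : E → ℝ} (hf : Measurable f)
    (hint : Integrable (f ∘ X t) P) (hmean : P[f ∘ X t | m] =ᵐ[P] 0)
    {B : Set Ω} (hB : MeasurableSet[m] B) {S : Finset ι} (ht : t ∉ S) {A : ι → Set E}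
    (hA : ∀ s ∈ S, MeasurableSet (A s)) :
    ∫ ω in B ∩ ⋂ s ∈ S, X s ⁻¹' A s, f (X t ω) ∂P = 0 := by
  classical
  set C : Set Ω := ⋂ s ∈ S, X s ⁻¹' A s with hC
  have hCm : MeasurableSet C := Finset.measurableSet_biInter S fun s hs => hmeas s (hA s hs)
  set φ : Ω → ℝ := P⟦C | m⟧ with hφ
  have hφm : StronglyMeasurable[m] φ := stronglyMeasurable_condExp
  have hφ0 : 0 ≤ᵐ[P] φ := condExp_nonneg (ae_of_all _ fun ω => Set.indicator_nonneg (by simp) ω)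
  have hφ1 : ∀ᵐ ω ∂P, |φ ω| ≤ 1 := by
    exact ae_bdd_abs_condExp_of_ae_bdd_abs (R := (1 : ℝ)) (ae_of_all _ fun ω => by
      by_cases h : ω ∈ C <;> simp [h])
  have hφi : Integrable φ P := integrable_condExp
  have hBm : MeasurableSet B := hm _ hB
  have hprod : ∀ A' : Set E, MeasurableSet A' →
      P⟦X t ⁻¹' A' ∩ C | m⟧ =ᵐ[P] P⟦X t ⁻¹' A' | m⟧ * φ := by
    intro A' hA'
    have h1 := hX (insert t S) (Function.update A t A') (by
      intro s hs
      by_cases hst : s = t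
      · subst hst; simpa using hA'
      · rw [Function.update_of_ne hst]
        exact hA s ((Finset.mem_insert.mp hs).resolve_left hst))
    have h2 := hX S A hA
    have hne : ∀ s ∈ S, Function.update A t A' s = A s := fun s hs =>
      Function.update_of_ne (ne_of_mem_of_not_mem hs ht) _ _
    rw [Finset.set_biInter_insert, Finset.prod_insert ht, Function.update_self] at h1
    have e1 : (⋂ s ∈ S, X s ⁻¹' Function.update A t A' s) = C := by
      rw [hC]
      exact Set.iInter₂_congr fun s hs => by rw [hne s hs]
    have e2 : ∏ s ∈ S, P⟦X s ⁻¹' Function.update A t A' s | m⟧ = ∏ s ∈ S, P⟦X s ⁻¹' A s | m⟧ :=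
      Finset.prod_congr rfl fun s hs => by rw [hne s hs]
    rw [e1, e2] at h1
    filter_upwards [h1, h2] with ω h1 h2
    rw [h1, Pi.mul_apply, Pi.mul_apply, hφ, h2]
  have hψ : Measurable fun ω => ENNReal.ofReal (φ ω) :=
    (hφm.mono hm).measurable.ennreal_ofReal
  -- Independence concerns sets only. Equality of the laws of X_t under 1_{B ∩ C} P and under φ 1_B
  -- P carries it over to the unbounded function f.
  have hmaps : (P.restrict (B ∩ C)).map (X t)
      = ((P.restrict B).withDensity fun ω => ENNReal.ofReal (φ ω)).map (X t) := by
    ext A' hA'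
    have hXA := hmeas t hA'
    have hind : Integrable ((X t ⁻¹' A').indicator fun _ => (1 : ℝ)) P :=
      (integrable_const _).indicator hXA
    have hpi : Integrable (fun ω => (X t ⁻¹' A').indicator (fun _ => (1 : ℝ)) ω * φ ω) P :=
      hφi.bdd_mul hind.1 (c := 1) (ae_of_all _ fun ω => by
        by_cases h : X t ω ∈ A' <;> simp [Set.indicator, h])
    rw [Measure.map_apply (hmeas t) hA', Measure.map_apply (hmeas t) hA',
      Measure.restrict_apply hXA, withDensity_apply _ hXA, Measure.restrict_restrict hXA,
      ← ofReal_integral_eq_lintegral_ofReal hφi.integrableOn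
        (ae_restrict_of_ae hφ0), ← ENNReal.ofReal_toReal (measure_ne_top P _)]
    congr 1
    change P.real _ = _
    have h1 : ∫ ω in B, (P⟦X t ⁻¹' A' ∩ C | m⟧) ω ∂P = P.real (X t ⁻¹' A' ∩ (B ∩ C)) := by
      rw [setIntegral_condExp hm ((integrable_const _).indicator (hXA.inter hCm)) hB,
        setIntegral_indicator (hXA.inter hCm)]
      simp only [integral_const, MeasurableSet.univ, measureReal_restrict_apply, Set.univ_inter,
        smul_eq_mul, mul_one]
      congr 1
      ext ω; simp; tauto
    rw [← h1]
    have h2 : P[fun ω => (X t ⁻¹' A').indicator (fun _ => (1 : ℝ)) ω * φ ω | m] =ᵐ[P]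
        P⟦X t ⁻¹' A' | m⟧ * φ := condExp_mul_of_stronglyMeasurable_right hφm hpi hind
    calc ∫ ω in B, (P⟦X t ⁻¹' A' ∩ C | m⟧) ω ∂P
        = ∫ ω in B, (P[fun ω => (X t ⁻¹' A').indicator (fun _ => (1 : ℝ)) ω * φ ω | m]) ω ∂P :=
          integral_congr_ae (ae_restrict_of_ae ((hprod A' hA').trans h2.symm))
      _ = ∫ ω in B, (X t ⁻¹' A').indicator (fun _ => (1 : ℝ)) ω * φ ω ∂P :=
          setIntegral_condExp hm hpi hB
      _ = ∫ ω in B, (X t ⁻¹' A').indicator φ ω ∂P := by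
          congr 1; ext ω; by_cases h : X t ω ∈ A' <;> simp [Set.indicator, h]
      _ = ∫ ω in X t ⁻¹' A' ∩ B, φ ω ∂P := by
          rw [setIntegral_indicator hXA, Set.inter_comm]
  have hfφ : Integrable (fun ω => f (X t ω) * φ ω) P :=
    Integrable.mul_bdd (c := 1) hint hφi.1 (by simpa using hφ1)
  calc ∫ ω in B ∩ C, f (X t ω) ∂P
      = ∫ x, f x ∂((P.restrict (B ∩ C)).map (X t)) :=
        (integral_map (hmeas t).aemeasurable hf.aestronglyMeasurable).symm
    _ = ∫ ω, f (X t ω) ∂((P.restrict B).withDensity fun ω => ENNReal.ofReal (φ ω)) := by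
        rw [hmaps]
        exact integral_map (hmeas t).aemeasurable hf.aestronglyMeasurable
    _ = ∫ ω in B, (ENNReal.ofReal (φ ω)).toReal • f (X t ω) ∂P :=
        integral_withDensity_eq_integral_toReal_smul hψ (ae_of_all _ fun _ => by simp) _
    _ = ∫ ω in B, f (X t ω) * φ ω ∂P := by
        refine integral_congr_ae (ae_restrict_of_ae ?_)
        filter_upwards [hφ0] with ω h
        rw [ENNReal.toReal_ofReal h, smul_eq_mul, mul_comm]
    _ = ∫ ω in B, (P[fun ω => f (X t ω) * φ ω | m]) ω ∂P := (setIntegral_condExp hm hfφ hB).symm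
    _ = ∫ ω in B, 0 ∂P := by
        refine integral_congr_ae (ae_restrict_of_ae ?_)
        filter_upwards [condExp_mul_of_stronglyMeasurable_right hφm hfφ hint, hmean] with ω h h'
        exact h.trans (mul_eq_zero_of_left h' _)
    _ = 0 := by simp

/-- The σ-algebra generated by `m` and all members of a family but one. -/
abbrev sigmaExcept (m : MeasurableSpace Ω) (X : ι → Ω → E) (t : ι) : MeasurableSpace Ω :=
  m ⊔ ⨆ s : {s // s ≠ t}, MeasurableSpace.comap (X s) inferInstance

/-- A π-λ argument: intersections of an event of `m` with finitely many events about single other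
members form a π-system generating `sigmaExcept`. -/
lemma CondIndepFamily.setIntegral_sigmaExcept (hX : CondIndepFamily m P X) (hm : m ≤ mΩ)
    (hmeas : ∀ t, Measurable (X t)) {t : ι} {f : E → ℝ} (hf : Measurable f)
    (hint : Integrable (f ∘ X t) P) (hmean : P[f ∘ X t | m] =ᵐ[P] 0)
    {B : Set Ω} (hB : MeasurableSet[sigmaExcept m X t] B) :
    ∫ ω in B, f (X t ω) ∂P = 0 := by
  classical
  -- The index `none` stands for `m`, so that `m` and the other members form one family of
  -- σ-algebras.
  set M : Option {s // s ≠ t} → MeasurableSpace Ω :=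
    fun o => o.elim m fun s => MeasurableSpace.comap (X s) inferInstance with hM
  have hMle : ∀ o, M o ≤ mΩ := by
    rintro (_ | s)
    · exact hm
    · exact (hmeas s).comap_le
  have hgen : sigmaExcept m X t
      = MeasurableSpace.generateFrom (piiUnionInter (fun o => {s | MeasurableSet[M o] s}) Set.univ) := by
    exact ((generateFrom_piiUnionInter_measurableSet M Set.univ).trans
      (by rw [iSup_univ, iSup_option]; rfl)).symm
  have hpi : IsPiSystem (piiUnionInter (fun o => {s | MeasurableSet[M o] s}) Set.univ) :=
    isPiSystem_piiUnionInter _ (fun o => @MeasurableSpace.isPiSystem_measurableSet _ (M o)) _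
  have hle : sigmaExcept m X t ≤ mΩ := sup_le hm (iSup_le fun s => (hmeas s).comap_le)
  have hbasic : ∀ s ∈ piiUnionInter (fun o => {s | MeasurableSet[M o] s}) Set.univ,
      ∫ ω in s, f (X t ω) ∂P = 0 := by
    rintro _ ⟨S, -, g, hg, rfl⟩
    have hB' : MeasurableSet[m] (if none ∈ S then g none else Set.univ) := by
      split_ifs with h
      · exact hg none h
      · exact @MeasurableSet.univ _ m
    have hex : ∀ s : {s // s ≠ t}, ∃ A : Set E, MeasurableSet A ∧
        (some s ∈ S → X s ⁻¹' A = g (some s)) := by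
      intro s
      by_cases h : some s ∈ S
      · obtain ⟨A, hA, hAe⟩ := hg (some s) h
        exact ⟨A, hA, fun _ => hAe⟩
      · exact ⟨Set.univ, MeasurableSet.univ, fun h' => absurd h' h⟩
    choose A hA hAe using hex
    have key := hX.setIntegral_comp_eq_zero hm hmeas hf hint hmean hB'
      (S := (Finset.eraseNone S).map (Function.Embedding.subtype _)) (t := t)
      (by simp) (A := fun s => if h : s ≠ t then A ⟨s, h⟩ else Set.univ) (by
        intro s _
        split_ifs
        · exact hA _
        · exact MeasurableSet.univ)
    convert key using 3
    ext ω
    simp only [Set.mem_iInter, Set.mem_inter_iff, Finset.mem_map, Finset.mem_eraseNone,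
      Function.Embedding.subtype_apply, Subtype.exists, exists_and_right, exists_eq_right]
    constructor
    · intro h
      refine ⟨?_, ?_⟩
      · split_ifs with hn
        · exact h none hn
        · trivial
      · rintro s ⟨hs, hsS⟩
        rw [dif_pos hs, hAe ⟨s, hs⟩ hsS]
        exact h _ hsS
    · rintro ⟨h1, h2⟩ (_ | s) ho
      · rwa [if_pos ho] at h1
      · have := h2 s ⟨s.2, ho⟩
        rwa [dif_pos s.2, hAe s ho] at this
  refine MeasurableSpace.induction_on_inter (m := sigmaExcept m X t)
    (C := fun B _ => ∫ ω in B, f (X t ω) ∂P = 0) hgen hpi (by simp)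
    (fun s hs => hbasic s hs) ?_ ?_ B hB
  · intro s hs h0
    have h1 : ∫ ω, f (X t ω) ∂P = 0 := by
      have := hbasic Set.univ ⟨∅, by simp, fun _ => Set.univ, by simp, by simp⟩
      simpa using this
    have h2 := integral_add_compl (hle _ hs) hint
    simp only [Function.comp_apply] at h2
    rw [h0, h1, zero_add] at h2
    exact h2
  · intro g hd hg h0
    exact (integral_iUnion (fun i => hle _ (hg i)) hd hint.integrableOn).trans
      (by simp [h0])

/-- Given `m`, a linear combination of mean-zero functions of one member of a conditionally
independent family, whose weights depend on `m` and on the other members, has mean zero as soon as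
it is integrable: the individual terms need not be. -/
lemma CondIndepFamily.integral_sum_mul_eq_zero (hX : CondIndepFamily m P X) (hm : m ≤ mΩ)
    (hmeas : ∀ t, Measurable (X t)) {t : ι} {κ : Type*} [Fintype κ] {f : κ → E → ℝ}
    (hf : ∀ i, Measurable (f i)) (hint : ∀ i, Integrable (f i ∘ X t) P)
    (hmean : ∀ i, P[f i ∘ X t | m] =ᵐ[P] 0) {Z : κ → Ω → ℝ}
    (hZ : ∀ i, Measurable[sigmaExcept m X t] (Z i))
    (hsum : Integrable (fun ω => ∑ i, f i (X t ω) * Z i ω) P) :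
    ∫ ω, ∑ i, f i (X t ω) * Z i ω ∂P = 0 := by
  classical
  have hle : sigmaExcept m X t ≤ mΩ := sup_le hm (iSup_le fun s => (hmeas s).comap_le)
  set G := sigmaExcept m X t
  have hcond : ∀ i, P[f i ∘ X t | G] =ᵐ[P] 0 := fun i =>
    (ae_eq_condExp_of_forall_setIntegral_eq hle (hint i) (fun _ _ _ => integrable_zero _ _ _ )
      (fun s hs _ => by
        have := hX.setIntegral_sigmaExcept hm hmeas (hf i) (hint i) (hmean i) hs
        simpa using this.symm) (stronglyMeasurable_zero.aestronglyMeasurable)).symm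
  -- Truncating all weights on one common event makes every summand integrable and commutes with the
  -- sum. The truncation is then removed by dominated convergence, with the absolute value of the
  -- whole sum as dominating function.
  set A : ℕ → Set Ω := fun n => {ω | ∀ i, |Z i ω| ≤ n} with hAdef
  have hA : ∀ n, MeasurableSet[G] (A n) := by
    intro n
    have : A n = ⋂ i, {ω | |Z i ω| ≤ n} := by ext; simp [hAdef]
    rw [this]
    refine @MeasurableSet.iInter _ _ G _ _ fun i => ?_
    exact (measurableSet_Iic (a := (n : ℝ))).preimage (measurable_abs.comp (hZ i))
  have htrunc : ∀ n, ∫ ω, (A n).indicator (fun ω => ∑ i, f i (X t ω) * Z i ω) ω ∂P = 0 := by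
    intro n
    have e : (A n).indicator (fun ω => ∑ i, f i (X t ω) * Z i ω)
        = fun ω => ∑ i, (f i ∘ X t) ω * (A n).indicator (Z i) ω := by
      ext ω
      by_cases h : ω ∈ A n <;> simp [h]
    have hZn : ∀ i, StronglyMeasurable[G] ((A n).indicator (Z i)) := fun i =>
      ((hZ i).indicator (hA n)).stronglyMeasurable
    have hi : ∀ i, Integrable (fun ω => (f i ∘ X t) ω * (A n).indicator (Z i) ω) P := fun i =>
      Integrable.mul_bdd (c := n) (hint i) ((hZn i).mono hle).aestronglyMeasurable
        (ae_of_all _ fun ω => by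
          by_cases h : ω ∈ A n
          · simpa [h] using h i
          · simp [h])
    rw [e, integral_finsetSum _ fun i _ => hi i]
    refine Finset.sum_eq_zero fun i _ => ?_
    rw [← integral_condExp hle]
    refine integral_eq_zero_of_ae ?_
    filter_upwards [condExp_mul_of_stronglyMeasurable_right (hZn i) (hi i) (hint i), hcond i]
      with ω h h'
    exact h.trans (by rw [Pi.mul_apply, h', Pi.zero_apply, zero_mul])
  have hlim := tendsto_integral_of_dominated_convergence (μ := P)
    (F := fun n => (A n).indicator (fun ω => ∑ i, f i (X t ω) * Z i ω))
    (f := fun ω => ∑ i, f i (X t ω) * Z i ω)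
    (fun ω => ‖∑ i, f i (X t ω) * Z i ω‖)
    (fun n => hsum.1.indicator (hle _ (hA n))) hsum.norm
    (fun n => ae_of_all _ fun ω => norm_indicator_le_norm_self _ _)
    (ae_of_all _ fun ω => by
      refine tendsto_const_nhds.congr' ?_
      obtain ⟨n, hn⟩ := exists_nat_ge (∑ i, |Z i ω|)
      filter_upwards [eventually_ge_atTop n] with k hk
      rw [Set.indicator_of_mem]
      intro i
      calc |Z i ω| ≤ ∑ i, |Z i ω| :=
            Finset.single_le_sum (f := fun i => |Z i ω|) (fun _ _ => abs_nonneg _) (Finset.mem_univ i)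
        _ ≤ n := hn
        _ ≤ k := by exact_mod_cast hk)
  simp only [htrunc] at hlim
  exact (tendsto_nhds_unique tendsto_const_nhds hlim).symm

end CondIndep

/-! ### Second-moment bounds for weighted sums of errors -/

/-- A sum of square-integrable variables, each of which is uncorrelated with all but at most two
of them. -/
lemma integral_sq_sum_le {Ω ι : Type*} [MeasurableSpace Ω] {P : Measure Ω} (s : Finset ι)
    (σ : ι → ι) {Y : ι → Ω → ℝ} {C : ℝ} (hC : 0 ≤ C) (hY : ∀ p ∈ s, MemLp (Y p) 2 P)
    (horth : ∀ p ∈ s, ∀ q ∈ s, q ≠ p → q ≠ σ p → ∫ ω, Y p ω * Y q ω ∂P = 0)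
    (hbd : ∀ p ∈ s, ∫ ω, Y p ω ^ 2 ∂P ≤ C) :
    Integrable (fun ω => (∑ p ∈ s, Y p ω) ^ 2) P ∧
      ∫ ω, (∑ p ∈ s, Y p ω) ^ 2 ∂P ≤ 2 * s.card * C := by
  classical
  have hint : ∀ p ∈ s, ∀ q ∈ s, Integrable (fun ω => Y p ω * Y q ω) P := fun p hp q hq =>
    (hY p hp).integrable_mul (hY q hq)
  have hexp : (fun ω => (∑ p ∈ s, Y p ω) ^ 2) = fun ω => ∑ p ∈ s, ∑ q ∈ s, Y p ω * Y q ω := by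
    ext ω
    rw [sq, Finset.sum_mul_sum]
  have hpq : ∀ p ∈ s, ∀ q ∈ s, ∫ ω, Y p ω * Y q ω ∂P ≤ C := by
    intro p hp q hq
    have h1 : ∫ ω, Y p ω * Y q ω ∂P ≤ ∫ ω, (1 / 2) * (Y p ω ^ 2 + Y q ω ^ 2) ∂P :=
      integral_mono (hint p hp q hq)
        (((hY p hp).integrable_sq.add (hY q hq).integrable_sq).const_mul _)
        fun ω => by
          dsimp only
          nlinarith [sq_nonneg (Y p ω - Y q ω)]
    rw [integral_const_mul, integral_add (hY p hp).integrable_sq (hY q hq).integrable_sq] at h1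
    linarith [hbd p hp, hbd q hq]
  rw [hexp]
  refine ⟨integrable_finsetSum _ fun p hp => integrable_finsetSum _ fun q hq => hint p hp q hq, ?_⟩
  rw [integral_finsetSum _ fun p hp => integrable_finsetSum _ fun q hq => hint p hp q hq]
  have hrow : ∀ p ∈ s, ∫ ω, ∑ q ∈ s, Y p ω * Y q ω ∂P ≤ 2 * C := by
    intro p hp
    rw [integral_finsetSum _ fun q hq => hint p hp q hq]
    calc ∑ q ∈ s, ∫ ω, Y p ω * Y q ω ∂P
        ≤ ∑ q ∈ s, ((if q = p then C else 0) + (if q = σ p then C else 0)) := by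
          refine Finset.sum_le_sum fun q hq => ?_
          split_ifs with h1 h2 h2
          · linarith [hpq p hp q hq]
          · linarith [hpq p hp q hq]
          · linarith [hpq p hp q hq]
          · simp [horth p hp q hq h1 h2]
      _ ≤ C + C := by
          rw [Finset.sum_add_distrib, Finset.sum_ite_eq', Finset.sum_ite_eq']
          gcongr
          · rw [if_pos hp]
          · split_ifs; exacts [le_rfl, hC]
      _ = 2 * C := by ring
  calc ∑ p ∈ s, ∫ ω, ∑ q ∈ s, Y p ω * Y q ω ∂P ≤ ∑ p ∈ s, 2 * C := Finset.sum_le_sum hrow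
    _ = 2 * s.card * C := by rw [Finset.sum_const, nsmul_eq_mul]; ring

lemma sqNorm_nonneg {ι : Type*} [Fintype ι] (x : ι → ℝ) : 0 ≤ sqNorm x :=
  Finset.sum_nonneg fun _ _ => sq_nonneg _

lemma sq_le_sqNorm {ι : Type*} [Fintype ι] (x : ι → ℝ) (a : ι) : x a ^ 2 ≤ sqNorm x :=
  Finset.single_le_sum (f := fun a => x a ^ 2) (fun _ _ => sq_nonneg _) (Finset.mem_univ a)

namespace Panel

variable {k₁ k₂ N T : ℕ} {Ω : Type*} (D : Panel k₁ k₂ N T Ω)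

/-- The factors augmented with a constant. -/
def augF (x : Option (Fac k₁ k₂)) (t : Fin T) (ω : Ω) : ℝ := x.elim 1 fun a => D.F t ω a

/-- `T⁻¹ ∑_{t ≠ s} F_{t,x} F_{s,y} ρ(t,s)` for the augmented factors. -/
def crossSum (x y : Option (Fac k₁ k₂)) (ω : Ω) : ℝ :=
  (T : ℝ)⁻¹ * ∑ p ∈ (Finset.univ : Finset (Fin T)).offDiag,
    D.augF x p.1 ω * D.augF y p.2 ω * D.rho p.1 p.2 ω

/-- `T^{-1/2} ∑ₜ F_{t,x} W_{t,a}` for the augmented factors. -/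
def loadSum (x : Option (Fac k₁ k₂)) (a : Fac k₁ k₂) (ω : Ω) : ℝ :=
  (√(T : ℝ))⁻¹ * ∑ t, D.augF x t ω * D.W t ω a

lemma augF_sq_le (x : Option (Fac k₁ k₂)) (t : Fin T) (ω : Ω) :
    D.augF x t ω ^ 2 ≤ 1 + sqNorm (D.F t ω) := by
  rcases x with _ | a
  · simp [augF, sqNorm_nonneg]
  · simpa [augF] using (sq_le_sqNorm (D.F t ω) a).trans (by linarith)

lemma augF_pow_four_le (x : Option (Fac k₁ k₂)) (t : Fin T) (ω : Ω) :
    (D.augF x t ω ^ 2) ^ 2 ≤ 1 + sqNorm (D.F t ω) ^ 2 := by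
  rcases x with _ | a
  · simp [augF, sq_nonneg]
  · have := pow_le_pow_left₀ (sq_nonneg _) (sq_le_sqNorm (D.F t ω) a) 2
    simpa [augF] using this.trans (by linarith)

lemma rho_comm (t s : Fin T) : D.rho t s = D.rho s t := by
  ext ω
  simp only [rho, mul_comm]

section Measurability

variable {G : MeasurableSpace Ω}

lemma measurable_augF {t : Fin T} (h : Measurable[G] (D.F t)) (x : Option (Fac k₁ k₂)) :
    Measurable[G] (D.augF x t) := by
  rcases x with _ | a
  · exact measurable_const
  · exact (measurable_pi_apply a).comp h

lemma measurable_rho {t s : Fin T} (ht : ∀ i, Measurable[G] (D.e i t))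
    (hs : ∀ i, Measurable[G] (D.e i s)) : Measurable[G] (D.rho t s) :=
  (Finset.measurable_fun_sum _ fun i _ => (ht i).mul (hs i)).const_mul _

lemma W_apply (t : Fin T) (ω : Ω) (a : Fac k₁ k₂) :
    D.W t ω a = (√(N : ℝ))⁻¹ * ∑ i, D.e i t ω * D.γ i a := by
  simp [W, Finset.sum_apply]

lemma measurable_W {t : Fin T} (ht : ∀ i, Measurable[G] (D.e i t)) (a : Fac k₁ k₂) :
    Measurable[G] fun ω => D.W t ω a := by
  simp only [W_apply]
  exact (Finset.measurable_fun_sum _ fun i _ => (ht i).mul_const _).const_mul _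

end Measurability

/-- Measurability of factors and errors, and conditional independence over time of the mean-zero
errors given the factors. -/
structure RegularErrors [MeasurableSpace Ω] (P : Measure Ω) : Prop where
  measurable_F : ∀ t, Measurable (D.F t)
  measurable_e : ∀ i t, Measurable (D.e i t)
  integrable_e : ∀ i t, Integrable (D.e i t) P
  cond_indep : CondIndepFamily D.factorSigma P (fun t ω i => D.e i t ω)
  cond_mean : ∀ i t, P[D.e i t | D.factorSigma] =ᵐ[P] 0

/-- The σ-algebra generated by the factors and by the errors of all periods but one. -/
abbrev othersSigma (t : Fin T) : MeasurableSpace Ω :=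
  sigmaExcept D.factorSigma (fun t ω i => D.e i t ω) t

lemma measurable_F_othersSigma (t s : Fin T) : Measurable[D.othersSigma t] (D.F s) := by
  have h : Measurable[D.factorSigma] (D.F s) :=
    (comap_measurable (D.F s)).mono (le_iSup (fun t : Fin T =>
      MeasurableSpace.comap (D.F t) inferInstance) s) le_rfl
  exact h.mono le_sup_left le_rfl

lemma measurable_e_othersSigma {t s : Fin T} (h : s ≠ t) (i : Fin N) :
    Measurable[D.othersSigma t] (D.e i s) := by
  have h1 : Measurable[MeasurableSpace.comap (fun ω i => D.e i s ω) inferInstance] (D.e i s) :=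
    (measurable_pi_apply i).comp (comap_measurable (fun ω i => D.e i s ω))
  refine h1.mono (le_trans ?_ le_sup_right) le_rfl
  exact le_iSup (fun s : {s // s ≠ t} =>
    MeasurableSpace.comap (fun ω i => D.e i s ω) inferInstance) ⟨s, h⟩

variable {D} {mΩ : MeasurableSpace Ω} {P : Measure Ω} [IsProbabilityMeasure P]

lemma RegularErrors.integral_sum_mul_eq_zero (h : D.RegularErrors P) {t : Fin T}
    {Z : Fin N → Ω → ℝ} (hZ : ∀ i, Measurable[D.othersSigma t] (Z i))
    (hsum : Integrable (fun ω => ∑ i, D.e i t ω * Z i ω) P) :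
    ∫ ω, ∑ i, D.e i t ω * Z i ω ∂P = 0 :=
  h.cond_indep.integral_sum_mul_eq_zero (iSup_le fun t => (h.measurable_F t).comap_le)
    (fun t => measurable_pi_lambda _ fun i => h.measurable_e i t) (t := t)
    (f := fun i x => x i) (fun i => measurable_pi_apply i) (fun i => h.integrable_e i t)
    (fun i => h.cond_mean i t) hZ hsum

/-- For s ≠ t, ρ(t,s) is linear in the errors of period t, with weights known once the factors and
the errors of the other periods are given. -/
lemma RegularErrors.integral_rho_mul_eq_zero (h : D.RegularErrors P) {t s : Fin T} (hst : s ≠ t)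
    {Z : Ω → ℝ} (hZ : Measurable[D.othersSigma t] Z)
    (hint : Integrable (fun ω => D.rho t s ω * Z ω) P) : ∫ ω, D.rho t s ω * Z ω ∂P = 0 := by
  have e : (fun ω => D.rho t s ω * Z ω)
      = fun ω => ∑ i, D.e i t ω * ((√(N : ℝ))⁻¹ * (D.e i s ω * Z ω)) := by
    ext ω
    rw [rho, Finset.mul_sum, Finset.sum_mul]
    exact Finset.sum_congr rfl fun i _ => by ring
  rw [e] at hint ⊢
  exact h.integral_sum_mul_eq_zero
    (fun i => ((D.measurable_e_othersSigma hst i).mul hZ).const_mul _) hint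

lemma RegularErrors.integral_W_mul_eq_zero (h : D.RegularErrors P) {t : Fin T} {a : Fac k₁ k₂}
    {Z : Ω → ℝ} (hZ : Measurable[D.othersSigma t] Z)
    (hint : Integrable (fun ω => D.W t ω a * Z ω) P) : ∫ ω, D.W t ω a * Z ω ∂P = 0 := by
  have e : (fun ω => D.W t ω a * Z ω)
      = fun ω => ∑ i, D.e i t ω * ((√(N : ℝ))⁻¹ * D.γ i a * Z ω) := by
    ext ω
    rw [W_apply, Finset.mul_sum, Finset.sum_mul]
    exact Finset.sum_congr rfl fun i _ => by ring
  rw [e] at hint ⊢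
  exact h.integral_sum_mul_eq_zero (fun i => hZ.const_mul _) hint

/-- Summands of different periods are orthogonal, so the second moment of the sum grows like T,
which the normalization cancels. -/
lemma RegularErrors.integral_loadSum_sq_le (h : D.RegularErrors P) {C : ℝ} (hT : 0 < T)
    (hW : ∀ t : Fin T, Integrable (fun ω => (1 + sqNorm (D.F t ω)) * sqNorm (D.W t ω)) P ∧
      ∫ ω, (1 + sqNorm (D.F t ω)) * sqNorm (D.W t ω) ∂P ≤ C)
    (x : Option (Fac k₁ k₂)) (a : Fac k₁ k₂) :
    Integrable (fun ω => D.loadSum x a ω ^ 2) P ∧ ∫ ω, D.loadSum x a ω ^ 2 ∂P ≤ 2 * C := by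
  set Y : Fin T → Ω → ℝ := fun t ω => D.augF x t ω * D.W t ω a with hYdef
  have hYm : ∀ t, Measurable (Y t) := fun t =>
    (D.measurable_augF (h.measurable_F t) x).mul (D.measurable_W (fun i => h.measurable_e i t) a)
  have hYsq : ∀ t ω, Y t ω ^ 2 ≤ (1 + sqNorm (D.F t ω)) * sqNorm (D.W t ω) := fun t ω => by
    rw [hYdef, mul_pow]
    exact mul_le_mul (D.augF_sq_le x t ω) (sq_le_sqNorm _ a) (sq_nonneg _)
      (by linarith [sqNorm_nonneg (D.F t ω)])
  have hYi : ∀ t, Integrable (fun ω => Y t ω ^ 2) P := fun t =>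
    (hW t).1.mono' ((hYm t).pow_const 2).aestronglyMeasurable (ae_of_all _ fun ω => by
      rw [Real.norm_of_nonneg (sq_nonneg _)]
      exact hYsq t ω)
  have hYb : ∀ t, ∫ ω, Y t ω ^ 2 ∂P ≤ C := fun t =>
    (integral_mono (hYi t) (hW t).1 (hYsq t)).trans (hW t).2
  have hC : 0 ≤ C := (integral_nonneg fun ω => sq_nonneg _).trans (hYb ⟨0, hT⟩)
  have hY2 : ∀ t, MemLp (Y t) 2 P := fun t =>
    (memLp_two_iff_integrable_sq (hYm t).aestronglyMeasurable).mpr (hYi t)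
  -- No summand has a second correlated partner here, so `id` serves as the partner map, at the
  -- price of a harmless factor 2.
  obtain ⟨h1, h2⟩ := integral_sq_sum_le Finset.univ id hC (fun t _ => hY2 t)
    (fun t _ s _ hst _ => by
      have e : (fun ω => Y t ω * Y s ω)
          = fun ω => D.W t ω a * (D.augF x t ω * Y s ω) := by
        ext ω; simp only [hYdef]; ring
      have hi : Integrable (fun ω => Y t ω * Y s ω) P := (hY2 t).integrable_mul (hY2 s)
      rw [e] at hi ⊢
      refine h.integral_W_mul_eq_zero ?_ hi
      exact (D.measurable_augF (D.measurable_F_othersSigma t t) x).mul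
        ((D.measurable_augF (D.measurable_F_othersSigma t s) x).mul
          (D.measurable_W (fun i => D.measurable_e_othersSigma hst i) a)))
    (fun t _ => hYb t)
  have e : (fun ω => D.loadSum x a ω ^ 2) = fun ω => (T : ℝ)⁻¹ * (∑ t, Y t ω) ^ 2 := by
    ext ω
    rw [loadSum, mul_pow, inv_pow, Real.sq_sqrt (Nat.cast_nonneg _)]
  rw [e]
  refine ⟨h1.const_mul _, ?_⟩
  rw [integral_const_mul]
  have hT' : (0 : ℝ) < T := by exact_mod_cast hT
  rw [Finset.card_univ, Fintype.card_fin] at h2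
  calc (T : ℝ)⁻¹ * ∫ ω, (∑ t, Y t ω) ^ 2 ∂P ≤ (T : ℝ)⁻¹ * (2 * T * C) := by gcongr
    _ = 2 * C := by field_simp

/-- Each ordered pair of periods correlates only with itself and its reversal. At most T² pairs thus
contribute at most 2C each, against the normalization T^(-2). -/
lemma RegularErrors.integral_crossSum_sq_le (h : D.RegularErrors P) {C : ℝ} (hT : 2 ≤ T)
    (hρ : ∀ t s : Fin T, s ≠ t →
      Integrable (fun ω => (1 + sqNorm (D.F t ω) ^ 2) * (D.rho s t ω ^ 2 + 1)) P ∧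
      ∫ ω, (1 + sqNorm (D.F t ω) ^ 2) * (D.rho s t ω ^ 2 + 1) ∂P < C)
    (x y : Option (Fac k₁ k₂)) :
    Integrable (fun ω => D.crossSum x y ω ^ 2) P ∧ ∫ ω, D.crossSum x y ω ^ 2 ∂P ≤ 2 * C := by
  set Y : Fin T × Fin T → Ω → ℝ :=
    fun p ω => D.augF x p.1 ω * D.augF y p.2 ω * D.rho p.1 p.2 ω with hYdef
  have hYm : ∀ p, Measurable (Y p) := fun p =>
    ((D.measurable_augF (h.measurable_F p.1) x).mul (D.measurable_augF (h.measurable_F p.2) y)).mul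
      (D.measurable_rho (fun i => h.measurable_e i p.1) (fun i => h.measurable_e i p.2))
  -- The squared product of two factor weights is at most the mean of their fourth powers, so the
  -- moment hypothesis is averaged over both orders of the pair.
  set U : Fin T × Fin T → Ω → ℝ := fun p ω => (1 / 2) *
    ((1 + sqNorm (D.F p.1 ω) ^ 2) * (D.rho p.2 p.1 ω ^ 2 + 1)
      + (1 + sqNorm (D.F p.2 ω) ^ 2) * (D.rho p.1 p.2 ω ^ 2 + 1)) with hU
  have hYsq : ∀ p ω, Y p ω ^ 2 ≤ U p ω := by
    intro p ω
    simp only [hYdef, hU]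
    rw [D.rho_comm p.2 p.1]
    have hx := D.augF_pow_four_le x p.1 ω
    have hy := D.augF_pow_four_le y p.2 ω
    have hxy : (D.augF x p.1 ω * D.augF y p.2 ω) ^ 2
        ≤ (1 / 2) * ((1 + sqNorm (D.F p.1 ω) ^ 2) + (1 + sqNorm (D.F p.2 ω) ^ 2)) := by
      nlinarith [sq_nonneg (D.augF x p.1 ω ^ 2 - D.augF y p.2 ω ^ 2)]
    have hρ1 : D.rho p.1 p.2 ω ^ 2 ≤ D.rho p.1 p.2 ω ^ 2 + 1 := by linarith
    rw [mul_pow]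
    calc _ ≤ (1 / 2) * ((1 + sqNorm (D.F p.1 ω) ^ 2) + (1 + sqNorm (D.F p.2 ω) ^ 2))
          * (D.rho p.1 p.2 ω ^ 2 + 1) := mul_le_mul hxy hρ1 (sq_nonneg _) (by positivity)
      _ = _ := by ring
  have hne : ∀ p ∈ (Finset.univ : Finset (Fin T)).offDiag, p.1 ≠ p.2 := fun p hp =>
    (Finset.mem_offDiag.mp hp).2.2
  have hUi : ∀ p : Fin T × Fin T, p.1 ≠ p.2 → Integrable (U p) P := fun p hp =>
    ((hρ p.1 p.2 hp.symm).1.add (hρ p.2 p.1 hp).1).const_mul _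
  have hUb : ∀ p : Fin T × Fin T, p.1 ≠ p.2 → ∫ ω, U p ω ∂P ≤ C := fun p hp => by
    simp only [hU]
    rw [integral_const_mul, integral_add (hρ p.1 p.2 hp.symm).1 (hρ p.2 p.1 hp).1]
    linarith [(hρ p.1 p.2 hp.symm).2, (hρ p.2 p.1 hp).2]
  have hYi : ∀ p : Fin T × Fin T, p.1 ≠ p.2 → Integrable (fun ω => Y p ω ^ 2) P := fun p hp =>
    (hUi p hp).mono' ((hYm p).pow_const 2).aestronglyMeasurable (ae_of_all _ fun ω => by
      rw [Real.norm_of_nonneg (sq_nonneg _)]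
      exact hYsq p ω)
  have hYb : ∀ p : Fin T × Fin T, p.1 ≠ p.2 → ∫ ω, Y p ω ^ 2 ∂P ≤ C := fun p hp =>
    (integral_mono (hYi p hp) (hUi p hp) (hYsq p)).trans (hUb p hp)
  have hC : 0 ≤ C := (integral_nonneg fun ω => sq_nonneg _).trans
    (hYb (⟨0, by omega⟩, ⟨1, by omega⟩) (by simp))
  have hY2 : ∀ p : Fin T × Fin T, p.1 ≠ p.2 → MemLp (Y p) 2 P := fun p hp =>
    (memLp_two_iff_integrable_sq (hYm p).aestronglyMeasurable).mpr (hYi p hp)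
  have hmeasY : ∀ (t : Fin T) (q : Fin T × Fin T), q.1 ≠ t → q.2 ≠ t →
      Measurable[D.othersSigma t] (Y q) := fun t q h1 h2 =>
    ((D.measurable_augF (D.measurable_F_othersSigma t q.1) x).mul
      (D.measurable_augF (D.measurable_F_othersSigma t q.2) y)).mul
      (D.measurable_rho (fun i => D.measurable_e_othersSigma h1 i)
        (fun i => D.measurable_e_othersSigma h2 i))
  obtain ⟨h1, h2⟩ := integral_sq_sum_le (Finset.univ : Finset (Fin T)).offDiag Prod.swap hC
    (fun p hp => hY2 p (hne p hp))
    (fun p hp q hq hqp hqs => by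
      have hp' := hne p hp
      have hq' := hne q hq
      have hi : Integrable (fun ω => Y p ω * Y q ω) P :=
        (hY2 p hp').integrable_mul (hY2 q hq')
      -- As q is neither p nor its reversal, one of the two periods of p is absent from q. The
      -- errors of that period enter the product only through ρ(p), so the expectation vanishes.
      by_cases hcase : q.1 ≠ p.1 ∧ q.2 ≠ p.1
      · have e : (fun ω => Y p ω * Y q ω) = fun ω => D.rho p.1 p.2 ω *
            (D.augF x p.1 ω * D.augF y p.2 ω * Y q ω) := by
          ext ω; simp only [hYdef]; ring
        rw [e] at hi ⊢
        exact h.integral_rho_mul_eq_zero hp'.symm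
          (((D.measurable_augF (D.measurable_F_othersSigma _ _) x).mul
            (D.measurable_augF (D.measurable_F_othersSigma _ _) y)).mul
            (hmeasY _ q hcase.1 hcase.2)) hi
      · have e : (fun ω => Y p ω * Y q ω) = fun ω => D.rho p.2 p.1 ω *
            (D.augF x p.1 ω * D.augF y p.2 ω * Y q ω) := by
          ext ω; simp only [hYdef, D.rho_comm p.2 p.1]; ring
        have hc : q.1 ≠ p.2 ∧ q.2 ≠ p.2 := by
          rw [Ne, Prod.ext_iff] at hqp hqs
          simp only [Prod.fst_swap, Prod.snd_swap] at hqs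
          constructor
          · intro h1
            rw [h1] at hcase hqs hq'
            tauto
          · intro h1
            rw [h1] at hcase hqp hq'
            tauto
        rw [e] at hi ⊢
        exact h.integral_rho_mul_eq_zero hp'
          (((D.measurable_augF (D.measurable_F_othersSigma _ _) x).mul
            (D.measurable_augF (D.measurable_F_othersSigma _ _) y)).mul
            (hmeasY _ q hc.1 hc.2)) hi)
    (fun p hp => hYb p (hne p hp))
  have e : (fun ω => D.crossSum x y ω ^ 2) = fun ω => ((T : ℝ)⁻¹) ^ 2 *
      (∑ p ∈ (Finset.univ : Finset (Fin T)).offDiag, Y p ω) ^ 2 := by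
    ext ω
    rw [crossSum, mul_pow]
  rw [e]
  refine ⟨h1.const_mul _, ?_⟩
  rw [integral_const_mul]
  have hT' : (0 : ℝ) < T := by
    have : 0 < T := by omega
    exact_mod_cast this
  have hcard : (((Finset.univ : Finset (Fin T)).offDiag.card : ℕ) : ℝ) ≤ (T : ℝ) ^ 2 := by
    rw [Finset.offDiag_card, Finset.card_univ, Fintype.card_fin, sq]
    exact_mod_cast Nat.sub_le _ _
  calc ((T : ℝ)⁻¹) ^ 2 * ∫ ω, (∑ p ∈ (Finset.univ : Finset (Fin T)).offDiag, Y p ω) ^ 2 ∂P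
      ≤ ((T : ℝ)⁻¹) ^ 2 * (2 * (T : ℝ) ^ 2 * C) := by
        gcongr
        exact h2.trans (by gcongr)
    _ = 2 * C := by field_simp

end Panel

/-! ### Exact decomposition of the cross-sectional error moments -/

namespace Panel

variable {k₁ k₂ N T : ℕ} {Ω : Type*} (D : Panel k₁ k₂ N T Ω)

/-- The demeaned factors augmented with a constant. -/
def augFtilde (x : Option (Fac k₁ k₂)) (t : Fin T) (ω : Ω) : ℝ :=
  x.elim 1 fun a => D.Ftilde t ω a

/-- The time average of the observed factors, extended by zero to the added constant. -/
def centering (x : Option (Fac k₁ k₂)) (ω : Ω) : ℝ := x.elim 0 fun a => D.avgF ω a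

/-- `√T` times the time average of `eᵢₜ F̃ₜ`, for the augmented factors. -/
def errAvg (x : Option (Fac k₁ k₂)) (i : Fin N) (ω : Ω) : ℝ :=
  √(T : ℝ) * ((T : ℝ)⁻¹ * ∑ t, D.e i t ω * D.augFtilde x t ω)

/-- Cross-sectional second moments of `errAvg`. -/
def errGram (x y : Option (Fac k₁ k₂)) (ω : Ω) : ℝ :=
  (N : ℝ)⁻¹ * ∑ i, D.errAvg x i ω * D.errAvg y i ω

/-- Cross-sectional cross moments of the normalized loadings and `errAvg`. -/
def loadErr (a : Fac k₁ k₂) (x : Option (Fac k₁ k₂)) (ω : Ω) : ℝ :=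
  (N : ℝ)⁻¹ * ∑ i, D.γ i a * D.errAvg x i ω

/-- With the constant adjoined as a factor, demeaning is a linear combination of augmented factors.
Sums with demeaned weights thus reduce to sums with raw weights, for which orthogonality is
available: the demeaned factors themselves involve all periods. -/
lemma augFtilde_eq (x : Option (Fac k₁ k₂)) (t : Fin T) (ω : Ω) :
    D.augFtilde x t ω = D.augF x t ω - D.centering x ω * D.augF none t ω := by
  rcases x with _ | a <;> simp [augFtilde, augF, centering, Ftilde]

lemma errGram_comm (x y : Option (Fac k₁ k₂)) (ω : Ω) : D.errGram x y ω = D.errGram y x ω := by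
  simp only [errGram, mul_comm]

/-- The diagonal t = s of the double time sum produces S_t. Off the diagonal, N⁻¹ ∑ᵢ eᵢₜ eᵢₛ =
N^(-1/2) ρ(t,s), and demeaning is expanded in both factors. -/
lemma errGram_eq (x y : Option (Fac k₁ k₂)) (ω : Ω) :
    D.errGram x y ω = (T : ℝ)⁻¹ * ∑ t, D.augFtilde x t ω * D.augFtilde y t ω * D.S t ω
      + ((√(N : ℝ))⁻¹ * D.crossSum x y ω
        - D.centering x ω * ((√(N : ℝ))⁻¹ * D.crossSum none y ω)
        - D.centering y ω * ((√(N : ℝ))⁻¹ * D.crossSum x none ω)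
        + D.centering x ω * (D.centering y ω * ((√(N : ℝ))⁻¹ * D.crossSum none none ω))) := by
  have hN : (N : ℝ)⁻¹ = (√(N : ℝ))⁻¹ * (√(N : ℝ))⁻¹ := by
    rw [← mul_inv, Real.mul_self_sqrt (Nat.cast_nonneg _)]
  have hT : √(T : ℝ) * (T : ℝ)⁻¹ * (√(T : ℝ) * (T : ℝ)⁻¹) = (T : ℝ)⁻¹ := by
    rcases eq_or_ne (T : ℝ) 0 with h | h
    · simp [h]
    · calc _ = (√(T : ℝ) * √(T : ℝ)) * ((T : ℝ)⁻¹ * (T : ℝ)⁻¹) := by ring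
        _ = _ := by rw [Real.mul_self_sqrt (Nat.cast_nonneg _)]; field_simp
  set Y : Fin T × Fin T → ℝ := fun p => D.augFtilde x p.1 ω * D.augFtilde y p.2 ω
    * ((N : ℝ)⁻¹ * ∑ i, D.e i p.1 ω * D.e i p.2 ω) with hY
  have h1 : D.errGram x y ω = (T : ℝ)⁻¹ * ∑ p : Fin T × Fin T, Y p := by
    calc D.errGram x y ω
        = (N : ℝ)⁻¹ * ∑ i, (√(T : ℝ) * (T : ℝ)⁻¹ * (√(T : ℝ) * (T : ℝ)⁻¹)) *
            ((∑ t, D.e i t ω * D.augFtilde x t ω) * ∑ s, D.e i s ω * D.augFtilde y s ω) := by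
          rw [errGram]
          congr 1
          exact Finset.sum_congr rfl fun i _ => by rw [errAvg, errAvg]; ring
      _ = (N : ℝ)⁻¹ * ∑ i, (T : ℝ)⁻¹ * ∑ p : Fin T × Fin T,
            (D.e i p.1 ω * D.augFtilde x p.1 ω) * (D.e i p.2 ω * D.augFtilde y p.2 ω) := by
          simp_rw [hT, Fintype.sum_mul_sum, Fintype.sum_prod_type]
      _ = (T : ℝ)⁻¹ * ∑ p : Fin T × Fin T, Y p := by
          rw [← Finset.mul_sum, Finset.sum_comm, mul_left_comm]
          congr 1
          rw [Finset.mul_sum]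
          refine Finset.sum_congr rfl fun p _ => ?_
          simp only [hY]
          rw [mul_left_comm]
          congr 1
          rw [Finset.mul_sum]
          exact Finset.sum_congr rfl fun i _ => by ring
  have hsplit : ∑ p : Fin T × Fin T, Y p
      = ∑ t, Y (t, t) + ∑ p ∈ (Finset.univ : Finset (Fin T)).offDiag, Y p := by
    rw [← Finset.univ_product_univ, ← Finset.diag_union_offDiag,
      Finset.sum_union (Finset.disjoint_diag_offDiag _), Finset.sum_diag]
  rw [h1, hsplit, mul_add]
  congr 1
  · congr 1
    refine Finset.sum_congr rfl fun t _ => ?_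
    simp only [hY, S, sq]
  · simp only [crossSum, Finset.mul_sum, ← Finset.sum_sub_distrib, ← Finset.sum_add_distrib]
    refine Finset.sum_congr rfl fun p _ => ?_
    simp only [hY, augFtilde_eq, rho, hN]
    ring

lemma loadErr_eq (a : Fac k₁ k₂) (x : Option (Fac k₁ k₂)) (ω : Ω) :
    D.loadErr a x ω = (√(N : ℝ))⁻¹ * D.loadSum x a ω
      - D.centering x ω * ((√(N : ℝ))⁻¹ * D.loadSum none a ω) := by
  have hN : (N : ℝ)⁻¹ = (√(N : ℝ))⁻¹ * (√(N : ℝ))⁻¹ := by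
    rw [← mul_inv, Real.mul_self_sqrt (Nat.cast_nonneg _)]
  have hT : √(T : ℝ) * (T : ℝ)⁻¹ = (√(T : ℝ))⁻¹ := by
    rw [← div_eq_mul_inv, Real.sqrt_div_self]
  have h : D.loadErr a x ω = (√(N : ℝ))⁻¹ * ((√(T : ℝ))⁻¹ * ∑ t, D.augFtilde x t ω * D.W t ω a) := by
    calc D.loadErr a x ω
        = (N : ℝ)⁻¹ * ∑ i, ∑ t, (√(T : ℝ))⁻¹ * (D.γ i a * (D.e i t ω * D.augFtilde x t ω)) := by
          simp only [loadErr, errAvg, ← mul_assoc, hT]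
          congr 1
          refine Finset.sum_congr rfl fun i _ => ?_
          rw [Finset.mul_sum]
          exact Finset.sum_congr rfl fun t _ => by ring
      _ = _ := by
          rw [Finset.sum_comm, hN]
          simp only [Finset.mul_sum, W_apply]
          refine Finset.sum_congr rfl fun t _ => Finset.sum_congr rfl fun i _ => by ring
  rw [h]
  simp only [loadSum, Finset.mul_sum, ← Finset.sum_sub_distrib, augFtilde_eq]
  exact Finset.sum_congr rfl fun t _ => by ring

end Panel

/-! ### Probability limits of the error moments -/

section Limits

variable {k₁ k₂ : ℕ} {Ω : ℕ → ℕ → Type*} [∀ N T, MeasurableSpace (Ω N T)]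
  {P : ∀ N T, Measure (Ω N T)}
  {D : ∀ N T, Panel k₁ k₂ N T (Ω N T)}
  {SigF OmF SigSF : Matrix (Fac k₁ k₂) (Fac k₁ k₂) ℝ}

variable (P) in
lemma tendsto_N_probFilter :
    Tendsto (fun x : Σ p : ℕ × ℕ, Ω p.1 p.2 => x.1.1) (probFilter P) atTop :=
  tendsto_fst.comp (tendsto_fst_probFilter P)

variable (P) in
lemma tendsto_T_probFilter :
    Tendsto (fun x : Σ p : ℕ × ℕ, Ω p.1 p.2 => x.1.2) (probFilter P) atTop :=
  tendsto_snd.comp (tendsto_fst_probFilter P)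

lemma eventually_two_le_T : ∀ᶠ p : ℕ × ℕ in atTop ×ˢ atTop, 2 ≤ p.2 :=
  tendsto_snd.eventually (eventually_ge_atTop 2)

lemma tendsto_sqrt_inv_atTop : Tendsto (fun n : ℕ => (√(n : ℝ))⁻¹) atTop (𝓝 0) :=
  tendsto_inv_atTop_zero.comp (Real.tendsto_sqrt_atTop.comp tendsto_natCast_atTop_atTop)

/-- Variables with bounded second moments vanish in probability after division by `√N`. -/
lemma tendsto_sqrt_inv_mul_zero {X : ∀ N T, Ω N T → ℝ} {C : ℝ}
    (hX : ∀ᶠ p : ℕ × ℕ in atTop ×ˢ atTop, Integrable (fun ω => X p.1 p.2 ω ^ 2) (P p.1 p.2) ∧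
      ∫ ω, X p.1 p.2 ω ^ 2 ∂(P p.1 p.2) ≤ C) :
    Tendsto (fun x : Σ p : ℕ × ℕ, Ω p.1 p.2 => (√(x.1.1 : ℝ))⁻¹ * X x.1.1 x.1.2 x.2)
      (probFilter P) (𝓝 0) := by
  have hc : Tendsto (fun p : ℕ × ℕ => (p.1 : ℝ)⁻¹ * C) (atTop ×ˢ atTop) (𝓝 0) := by
    have := (tendsto_inv_atTop_zero.comp
      (tendsto_natCast_atTop_atTop (R := ℝ))).comp (tendsto_fst (f := atTop (α := ℕ)) (g := atTop (α := ℕ)))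
    simpa using this.mul_const C
  refine tendsto_zero_of_integral_sq (X := fun N T ω => (√(N : ℝ))⁻¹ * X N T ω) hc ?_
  filter_upwards [hX] with p ⟨h1, h2⟩
  simp only [mul_pow, inv_pow, Real.sq_sqrt (Nat.cast_nonneg (α := ℝ) _)]
  refine ⟨h1.const_mul _, ?_⟩
  rw [integral_const_mul]
  gcongr

/-- The factor means are uniformly bounded, although they may change with `N` and `T`. -/
lemma exists_bound_meanF (hE : Errors P D SigSF) :
    ∃ C : ℝ, ∀ N T, 2 ≤ T → ∀ (t : Fin T) a, |(D N T).meanF (P N T) t a| ≤ C := by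
  obtain ⟨C, hC⟩ := hE.rho_bound
  refine ⟨C, fun N T hT t a => ?_⟩
  have : Nontrivial (Fin T) := Fin.nontrivial_iff_two_le.mpr hT
  -- The moment hypothesis bounds the fourth moment of F_t only jointly with a second period, hence
  -- the requirement T ≥ 2.
  obtain ⟨s, hs⟩ := exists_ne t
  obtain ⟨h1, h2⟩ := hC N T t s hs
  rw [Panel.meanF, ← Real.norm_eq_abs]
  refine (norm_integral_le_of_norm_le h1 (ae_of_all _ fun ω => ?_)).trans h2.le
  have hx : ‖(D N T).F t ω a‖ ≤ 1 + sqNorm ((D N T).F t ω) ^ 2 := by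
    have hb := sq_le_sqNorm ((D N T).F t ω) a
    rw [Real.norm_eq_abs, abs_le]
    constructor <;> nlinarith [sq_nonneg ((D N T).F t ω a - 1), sq_nonneg ((D N T).F t ω a + 1),
      sq_nonneg (sqNorm ((D N T).F t ω) - 1)]
  refine hx.trans (le_mul_of_one_le_right (by positivity) ?_)
  linarith [sq_nonneg ((D N T).rho s t ω)]

variable [∀ N T, IsProbabilityMeasure (P N T)]

lemma Errors.regularErrors (hE : Errors P D SigSF) (hF : Factors P D SigF OmF) (N T : ℕ) :
    (D N T).RegularErrors (P N T) where
  measurable_F t := hF.measurable N T t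
  measurable_e := hE.measurable N T
  integrable_e := hE.integrable N T
  cond_indep := hE.cond_indep N T
  cond_mean := hE.cond_mean N T

lemma tendsto_crossSum (hF : Factors P D SigF OmF) (hE : Errors P D SigSF)
    (x y : Option (Fac k₁ k₂)) :
    Tendsto (fun z : Σ p : ℕ × ℕ, Ω p.1 p.2 =>
      (√(z.1.1 : ℝ))⁻¹ * (D z.1.1 z.1.2).crossSum x y z.2) (probFilter P) (𝓝 0) := by
  obtain ⟨C, hC⟩ := hE.rho_bound
  refine tendsto_sqrt_inv_mul_zero (C := 2 * C) (X := fun N T => (D N T).crossSum x y) ?_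
  filter_upwards [eventually_two_le_T] with p hp
  exact (hE.regularErrors hF p.1 p.2).integral_crossSum_sq_le hp (hC p.1 p.2) x y

lemma tendsto_loadSum (hF : Factors P D SigF OmF) (hE : Errors P D SigSF)
    (x : Option (Fac k₁ k₂)) (a : Fac k₁ k₂) :
    Tendsto (fun z : Σ p : ℕ × ℕ, Ω p.1 p.2 =>
      (√(z.1.1 : ℝ))⁻¹ * (D z.1.1 z.1.2).loadSum x a z.2) (probFilter P) (𝓝 0) := by
  obtain ⟨C, hC⟩ := hE.W_bound
  refine tendsto_sqrt_inv_mul_zero (C := 2 * C) (X := fun N T => (D N T).loadSum x a) ?_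
  filter_upwards [eventually_two_le_T] with p hp
  exact (hE.regularErrors hF p.1 p.2).integral_loadSum_sq_le (by omega) (hC p.1 p.2) x a

/-- The average deviation of the factors from their means vanishes in probability. -/
lemma tendsto_avg_deviation (hF : Factors P D SigF OmF) :
    Tendsto (fun z : Σ p : ℕ × ℕ, Ω p.1 p.2 => (z.1.2 : ℝ)⁻¹ •
      ∑ t : Fin z.1.2, ((D z.1.1 z.1.2).F t z.2 - (D z.1.1 z.1.2).meanF (P z.1.1 z.1.2) t))
      (probFilter P) (𝓝 0) := by
  have ha : Tendsto (fun p : ℕ × ℕ => (√(p.2 : ℝ))⁻¹) (atTop ×ˢ atTop) (𝓝 0) :=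
    tendsto_sqrt_inv_atTop.comp tendsto_snd
  have h := tendsto_smul_zero_of_tendstoInDistribution hF.clt ha
  have h' := (PiLp.continuous_ofLp 2 (fun _ : Fac k₁ k₂ => ℝ)).continuousAt.tendsto.comp h
  rw [WithLp.ofLp_zero] at h'
  refine h'.congr fun z => ?_
  simp only [Function.comp_apply, WithLp.ofLp_smul, smul_smul]
  rw [← mul_inv, Real.mul_self_sqrt (Nat.cast_nonneg _)]

lemma tendsto_lamTilde (hF : Factors P D SigF OmF) (lam : Fac k₁ k₂ → ℝ) :
    Tendsto (fun z : Σ p : ℕ × ℕ, Ω p.1 p.2 =>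
      (D z.1.1 z.1.2).lamTilde (P z.1.1 z.1.2) lam z.2) (probFilter P) (𝓝 lam) := by
  have := (tendsto_avg_deviation hF).const_add lam
  rwa [add_zero] at this

/-- The sample mean is its deviation from the expectation, which vanishes, plus an average of
uniformly bounded expectations. -/
lemma isBigO_centering (hF : Factors P D SigF OmF) (hE : Errors P D SigSF)
    (x : Option (Fac k₁ k₂)) :
    (fun z : Σ p : ℕ × ℕ, Ω p.1 p.2 => (D z.1.1 z.1.2).centering x z.2)
      =O[probFilter P] (fun _ => (1 : ℝ)) := by
  rcases x with _ | a
  · exact Asymptotics.isBigO_zero _ _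
  obtain ⟨C, hC⟩ := exists_bound_meanF hE
  have h1 := (tendsto_pi_nhds.mp (tendsto_avg_deviation hF) a).isBigO_one ℝ
  have h2 : (fun z : Σ p : ℕ × ℕ, Ω p.1 p.2 => (z.1.2 : ℝ)⁻¹ *
      ∑ t : Fin z.1.2, (D z.1.1 z.1.2).meanF (P z.1.1 z.1.2) t a)
      =O[probFilter P] (fun _ => (1 : ℝ)) := by
    refine Asymptotics.IsBigO.of_bound C ?_
    filter_upwards [(tendsto_fst_probFilter P).eventually eventually_two_le_T] with z hz
    have hT : (0 : ℝ) < z.1.2 := by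
      have : 0 < z.1.2 := by omega
      exact_mod_cast this
    rw [norm_one, mul_one, norm_mul, norm_inv, Real.norm_of_nonneg hT.le, inv_mul_le_iff₀ hT]
    refine (norm_sum_le _ _).trans ?_
    refine (Finset.sum_le_sum fun t _ => hC z.1.1 z.1.2 hz t a).trans ?_
    simp
  refine (h1.add h2).congr_left fun z => ?_
  simp only [Panel.centering, Option.elim_some, Panel.avgF, Pi.smul_apply, Finset.sum_apply,
    Pi.sub_apply, smul_eq_mul, Finset.sum_sub_distrib]
  ring

lemma tendsto_centering_mul (hF : Factors P D SigF OmF) (hE : Errors P D SigSF)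
    (x : Option (Fac k₁ k₂)) {f : (Σ p : ℕ × ℕ, Ω p.1 p.2) → ℝ}
    (hf : Tendsto f (probFilter P) (𝓝 0)) :
    Tendsto (fun z : Σ p : ℕ × ℕ, Ω p.1 p.2 => (D z.1.1 z.1.2).centering x z.2 * f z)
      (probFilter P) (𝓝 0) := by
  have := (isBigO_centering hF hE x).mul_isLittleO ((Asymptotics.isLittleO_one_iff ℝ).mpr hf)
  simpa using this

lemma tendsto_loadErr (hF : Factors P D SigF OmF) (hE : Errors P D SigSF)
    (a : Fac k₁ k₂) (x : Option (Fac k₁ k₂)) :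
    Tendsto (fun z : Σ p : ℕ × ℕ, Ω p.1 p.2 => (D z.1.1 z.1.2).loadErr a x z.2)
      (probFilter P) (𝓝 0) := by
  have := (tendsto_loadSum hF hE x a).sub
    (tendsto_centering_mul hF hE x (tendsto_loadSum hF hE none a))
  rw [sub_zero] at this
  exact this.congr fun z => ((D z.1.1 z.1.2).loadErr_eq a x z.2).symm

lemma tendsto_errGram_of_diag (hF : Factors P D SigF OmF) (hE : Errors P D SigSF)
    (x y : Option (Fac k₁ k₂)) {c : ℝ}
    (h : Tendsto (fun z : Σ p : ℕ × ℕ, Ω p.1 p.2 => (z.1.2 : ℝ)⁻¹ * ∑ t,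
      (D z.1.1 z.1.2).augFtilde x t z.2 * (D z.1.1 z.1.2).augFtilde y t z.2
        * (D z.1.1 z.1.2).S t z.2) (probFilter P) (𝓝 c)) :
    Tendsto (fun z : Σ p : ℕ × ℕ, Ω p.1 p.2 => (D z.1.1 z.1.2).errGram x y z.2)
      (probFilter P) (𝓝 c) := by
  have := h.add ((((tendsto_crossSum hF hE x y).sub
    (tendsto_centering_mul hF hE x (tendsto_crossSum hF hE none y))).sub
    (tendsto_centering_mul hF hE y (tendsto_crossSum hF hE x none))).add
    (tendsto_centering_mul hF hE x (tendsto_centering_mul hF hE y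
      (tendsto_crossSum hF hE none none))))
  simp only [sub_zero, add_zero] at this
  exact this.congr fun z => ((D z.1.1 z.1.2).errGram_eq x y z.2).symm

lemma tendsto_errGram_some (hF : Factors P D SigF OmF) (hE : Errors P D SigSF)
    (a b : Fac k₁ k₂) :
    Tendsto (fun z : Σ p : ℕ × ℕ, Ω p.1 p.2 => (D z.1.1 z.1.2).errGram (some a) (some b) z.2)
      (probFilter P) (𝓝 (SigSF a b)) :=
  tendsto_errGram_of_diag hF hE _ _ (by
    simpa only [Panel.augFtilde, Option.elim_some] using tendstoInProb_iff.mp (hE.FFS a b))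

lemma tendsto_errGram_none (hF : Factors P D SigF OmF) (hE : Errors P D SigSF)
    (a : Fac k₁ k₂) :
    Tendsto (fun z : Σ p : ℕ × ℕ, Ω p.1 p.2 => (D z.1.1 z.1.2).errGram (some a) none z.2)
      (probFilter P) (𝓝 0) := by
  refine tendsto_errGram_of_diag hF hE _ _ ?_
  have h1 := (tendsto_pi_nhds.mp (tendstoInProb_iff.mp hE.FS)) a
  have h2 := (tendsto_sqrt_inv_atTop.comp (tendsto_N_probFilter P)).mul h1
  -- The assumption controls the sum at scale √N/T; only the weaker scale 1/T is needed here.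
  rw [zero_mul] at h2
  refine h2.congr' ?_
  filter_upwards [(tendsto_N_probFilter P).eventually (eventually_gt_atTop 0)] with z hz
  have hN : √(z.1.1 : ℝ) ≠ 0 := (Real.sqrt_pos.mpr (by exact_mod_cast hz)).ne'
  simp only [Function.comp_apply, Panel.augFtilde, Option.elim_some, Option.elim_none,
    Pi.smul_apply, Finset.sum_apply, smul_eq_mul, mul_one]
  rw [← mul_assoc]
  congr 1
  · field_simp
  · exact Finset.sum_congr rfl fun t _ => mul_comm _ _

/-- `Σ_{SF²}` is positive semidefinite, as a limit of positive semidefinite matrices. -/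
lemma Errors.posSemidef (hF : Factors P D SigF OmF) (hE : Errors P D SigSF) :
    SigSF.PosSemidef := by
  refine PosSemidef.of_dotProduct_mulVec_nonneg ?_ fun x => ?_
  · ext a b
    rw [conjTranspose_apply, star_trivial]
    refine tendsto_nhds_unique (tendsto_errGram_some hF hE b a) ?_
    exact (tendsto_errGram_some hF hE a b).congr fun z =>
      (D z.1.1 z.1.2).errGram_comm _ _ _
  · have h : Tendsto (fun z : Σ p : ℕ × ℕ, Ω p.1 p.2 => ∑ a, x a * ∑ b,
        (D z.1.1 z.1.2).errGram (some a) (some b) z.2 * x b) (probFilter P)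
        (𝓝 (∑ a, x a * ∑ b, SigSF a b * x b)) :=
      tendsto_finsetSum _ fun a _ => (tendsto_finsetSum _ fun b _ =>
        (tendsto_errGram_some hF hE a b).mul_const _).const_mul _
    refine ge_of_tendsto h (Eventually.of_forall fun z => ?_)
    -- The quadratic form is a cross-sectional average of squares.
    have e : ∑ a, x a * ∑ b, (D z.1.1 z.1.2).errGram (some a) (some b) z.2 * x b
        = (z.1.1 : ℝ)⁻¹ * ∑ i, (∑ a, x a * (D z.1.1 z.1.2).errAvg (some a) i z.2) ^ 2 := by
      simp only [Panel.errGram, sq, Finset.mul_sum, Finset.sum_mul]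
      rw [Finset.sum_comm]
      conv_rhs => rw [Finset.sum_comm, Finset.sum_congr rfl fun _ _ => Finset.sum_comm]
      rw [Finset.sum_comm]
      refine Finset.sum_congr rfl fun a _ => Finset.sum_congr rfl fun b _ =>
        Finset.sum_congr rfl fun i _ => by ring
    rw [e]
    positivity

end Limits

/-! ### Finite-sample algebra of the two-pass estimate -/

namespace Panel

variable {k₁ k₂ N T : ℕ} {Ω : Type*} (D : Panel k₁ k₂ N T Ω)

/-- The normalization of the loadings: `γᵢ = loadScale *ᵥ βᵢ`. -/
def loadScale (k₁ k₂ T : ℕ) : Matrix (Fac k₁ k₂) (Fac k₁ k₂) ℝ :=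
  diagonal (Sum.elim (fun _ => 1) fun _ => √(T : ℝ))

/-- The normalization of the errors of the first-pass estimates. -/
def errScale (k₁ k₂ T : ℕ) : Matrix (Fac k₁ k₂) (Fac k₁ k₂) ℝ :=
  diagonal (Sum.elim (fun _ => (√(T : ℝ))⁻¹) fun _ => 1)

/-- The normalization of the risk premia. -/
def premScale (k₁ k₂ T : ℕ) : Matrix (Fac k₁ k₂) (Fac k₁ k₂) ℝ :=
  diagonal (Sum.elim (fun _ => √(T : ℝ)) fun _ => 1)

/-- The sample covariance matrix of the factors. -/
def sampleCov (ω : Ω) : Matrix (Fac k₁ k₂) (Fac k₁ k₂) ℝ :=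
  of fun a b => (T : ℝ)⁻¹ * ∑ t : Fin T, D.Ftilde t ω a * D.Ftilde t ω b

/-- `√T` times the sample covariance of the factors and the errors of asset `i`. -/
def errVec (i : Fin N) (ω : Ω) : Fac k₁ k₂ → ℝ := fun a => D.errAvg (some a) i ω

/-- Cross-sectional second moments of `errVec`. -/
def errMat (ω : Ω) : Matrix (Fac k₁ k₂) (Fac k₁ k₂) ℝ :=
  of fun a b => D.errGram (some a) (some b) ω

/-- Cross-sectional cross moments of the normalized loadings and `errVec`. -/
def loadErrMat (ω : Ω) : Matrix (Fac k₁ k₂) (Fac k₁ k₂) ℝ :=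
  of fun a b => D.loadErr a (some b) ω

/-- Cross-sectional second moments of the normalized loadings. -/
def loadMat : Matrix (Fac k₁ k₂) (Fac k₁ k₂) ℝ := (N : ℝ)⁻¹ • ∑ i, vecMulVec (D.γ i) (D.γ i)

/-- The normalized Gram matrix of the first-pass estimates. -/
def scaledGram (ω : Ω) : Matrix (Fac k₁ k₂) (Fac k₁ k₂) ℝ :=
  (N : ℝ)⁻¹ • (loadScale k₁ k₂ T * D.gram ω * loadScale k₁ k₂ T)

lemma sum_Ftilde (ω : Ω) : ∑ t, D.Ftilde t ω = 0 := by
  rcases Nat.eq_zero_or_pos T with rfl | hT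
  · simp
  have hT' : (T : ℝ) ≠ 0 := by exact_mod_cast hT.ne'
  simp only [Ftilde, Finset.sum_sub_distrib, Finset.sum_const, Finset.card_univ, Fintype.card_fin]
  rw [avgF, ← Nat.cast_smul_eq_nsmul ℝ, smul_smul, mul_inv_cancel₀ hT', one_smul, sub_self]

lemma loadScale_mulVec (i : Fin N) : loadScale k₁ k₂ T *ᵥ D.β i = D.γ i := by
  ext a
  rw [loadScale, mulVec_diagonal]
  rcases a with a | a <;> simp [γ]

lemma loadScale_transpose : (loadScale k₁ k₂ T)ᵀ = loadScale k₁ k₂ T := diagonal_transpose _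

lemma sqrt_inv_smul_loadScale (hT : 0 < T) :
    (√(T : ℝ))⁻¹ • loadScale k₁ k₂ T = errScale k₁ k₂ T := by
  have hT' : √(T : ℝ) ≠ 0 := (Real.sqrt_pos.mpr (by exact_mod_cast hT)).ne'
  rw [loadScale, errScale, ← diagonal_smul]
  congr 1
  ext a
  rcases a with a | a <;> simp [hT']

lemma premScale_mul_loadScale : premScale k₁ k₂ T * loadScale k₁ k₂ T = √(T : ℝ) • 1 := by
  rw [loadScale, premScale, diagonal_mul_diagonal, ← diagonal_one, ← diagonal_smul]
  congr 1
  ext a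
  rcases a with a | a <;> simp

lemma isUnit_det_loadScale (hT : 0 < T) : IsUnit (loadScale k₁ k₂ T).det := by
  have hT' : √(T : ℝ) ≠ 0 := (Real.sqrt_pos.mpr (by exact_mod_cast hT)).ne'
  rw [loadScale, det_diagonal, isUnit_iff_ne_zero, Finset.prod_ne_zero_iff]
  rintro (a | a) - <;> simp [hT']

lemma sum_vecMulVec_Ftilde (hT : 0 < T) (ω : Ω) :
    ∑ t, vecMulVec (D.Ftilde t ω) (D.Ftilde t ω) = (T : ℝ) • D.sampleCov ω := by
  have hT' : (T : ℝ) ≠ 0 := by exact_mod_cast hT.ne'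
  ext a b
  simp [Matrix.sum_apply, vecMulVec_apply, sampleCov, mul_inv_cancel_left₀ hT']

lemma errVec_eq (i : Fin N) (ω : Ω) :
    D.errVec i ω = √(T : ℝ) • ((T : ℝ)⁻¹ • ∑ t, D.e i t ω • D.Ftilde t ω) := by
  ext a
  simp [errVec, errAvg, augFtilde, Finset.sum_apply]

lemma inv_smul_sum_eq (hT : 0 < T) (i : Fin N) (ω : Ω) :
    (T : ℝ)⁻¹ • ∑ t, D.e i t ω • D.Ftilde t ω = (√(T : ℝ))⁻¹ • D.errVec i ω := by
  have hT' : √(T : ℝ) ≠ 0 := (Real.sqrt_pos.mpr (by exact_mod_cast hT)).ne'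
  rw [errVec_eq, smul_smul, inv_mul_cancel₀ hT', one_smul]

lemma u_eq (hT : 0 < T) (SigF : Matrix (Fac k₁ k₂) (Fac k₁ k₂) ℝ) (i : Fin N) (ω : Ω) :
    D.u SigF i ω = (√(T : ℝ))⁻¹ • (SigF⁻¹ *ᵥ D.errVec i ω) := by
  rw [← mulVec_smul, ← inv_smul_sum_eq D hT, mulVec_smul, u]
  congr 1
  simp only [mulVec_sum, mulVec_smul]

section Algebra

variable {D} {lam μ : Fac k₁ k₂ → ℝ} {ω : Ω}

/-- The part of the return that is constant over time drops out because the demeaned factors sum to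
zero. -/
lemma sum_r_smul_Ftilde (hT : 0 < T)
    (hr : ∀ i t, D.r i t ω = lam ⬝ᵥ D.β i + (D.F t ω - μ) ⬝ᵥ D.β i + D.e i t ω) (i : Fin N) :
    ∑ t, D.r i t ω • D.Ftilde t ω
      = ((T : ℝ) • D.sampleCov ω) *ᵥ D.β i + ∑ t, D.e i t ω • D.Ftilde t ω := by
  have h : ∀ t, D.r i t ω • D.Ftilde t ω
      = (lam ⬝ᵥ D.β i + (D.avgF ω - μ) ⬝ᵥ D.β i) • D.Ftilde t ω
        + vecMulVec (D.Ftilde t ω) (D.Ftilde t ω) *ᵥ D.β i + D.e i t ω • D.Ftilde t ω := by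
    intro t
    rw [hr, vecMulVec_mulVec, op_smul_eq_smul, ← add_smul, ← add_smul]
    congr 1
    rw [Ftilde, sub_dotProduct, sub_dotProduct, sub_dotProduct]
    ring
  rw [← sum_vecMulVec_Ftilde D hT, sum_mulVec]
  simp only [h, Finset.sum_add_distrib, ← Finset.smul_sum, sum_Ftilde, smul_zero, zero_add]

lemma betaHat_eq (hT : 0 < T) (hS : IsUnit (D.sampleCov ω).det)
    (hr : ∀ i t, D.r i t ω = lam ⬝ᵥ D.β i + (D.F t ω - μ) ⬝ᵥ D.β i + D.e i t ω) (i : Fin N) :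
    D.betaHat i ω = D.β i + (√(T : ℝ))⁻¹ • ((D.sampleCov ω)⁻¹ *ᵥ D.errVec i ω) := by
  have hT' : (T : ℝ) ≠ 0 := by exact_mod_cast hT.ne'
  have hinv : ((T : ℝ) • D.sampleCov ω)⁻¹ = (T : ℝ)⁻¹ • (D.sampleCov ω)⁻¹ := by
    have : Invertible (T : ℝ) := invertibleOfNonzero hT'
    rw [inv_smul _ _ hS, invOf_eq_inv]
  rw [betaHat, sum_r_smul_Ftilde hT hr, sum_vecMulVec_Ftilde D hT, mulVec_add, hinv]
  congr 1
  · rw [mulVec_mulVec, smul_mul_smul_comm, inv_mul_cancel₀ hT', nonsing_inv_mul _ hS, one_smul,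
      one_mulVec]
  · rw [smul_mulVec, ← mulVec_smul, inv_smul_sum_eq D hT, mulVec_smul]

/-- Signal plus noise on a common scale: `errScale` shrinks the noise in the strong block but leaves
it intact in the weak block. -/
lemma loadScale_mulVec_betaHat (hT : 0 < T) (hS : IsUnit (D.sampleCov ω).det)
    (hr : ∀ i t, D.r i t ω = lam ⬝ᵥ D.β i + (D.F t ω - μ) ⬝ᵥ D.β i + D.e i t ω) (i : Fin N) :
    loadScale k₁ k₂ T *ᵥ D.betaHat i ω
      = D.γ i + (errScale k₁ k₂ T * (D.sampleCov ω)⁻¹) *ᵥ D.errVec i ω := by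
  rw [betaHat_eq hT hS hr, mulVec_add, loadScale_mulVec, mulVec_smul, ← smul_mulVec,
    sqrt_inv_smul_loadScale hT, mulVec_mulVec]

lemma avgR_eq (hT : 0 < T)
    (hr : ∀ i t, D.r i t ω = lam ⬝ᵥ D.β i + (D.F t ω - μ) ⬝ᵥ D.β i + D.e i t ω) (i : Fin N) :
    D.avgR i ω = (lam + (T : ℝ)⁻¹ • ∑ t : Fin T, (D.F t ω - μ)) ⬝ᵥ D.β i
      + (√(T : ℝ))⁻¹ * D.errAvg none i ω := by
  have hT' : (T : ℝ) ≠ 0 := by exact_mod_cast hT.ne'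
  have hT2 : √(T : ℝ) ≠ 0 := (Real.sqrt_pos.mpr (by exact_mod_cast hT)).ne'
  simp only [avgR, hr, errAvg, augFtilde, Option.elim_none, mul_one, Finset.sum_add_distrib,
    Finset.sum_const, Finset.card_univ, Fintype.card_fin, nsmul_eq_mul, add_dotProduct,
    smul_dotProduct, sum_dotProduct, smul_eq_mul]
  rw [inv_mul_cancel_left₀ hT2]
  field_simp

lemma errMat_eq (D : Panel k₁ k₂ N T Ω) (ω : Ω) :
    D.errMat ω = (N : ℝ)⁻¹ • ∑ i, vecMulVec (D.errVec i ω) (D.errVec i ω) := by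
  ext a b
  simp [errMat, errGram, errVec, Matrix.sum_apply, vecMulVec_apply]

lemma loadErrMat_eq (D : Panel k₁ k₂ N T Ω) (ω : Ω) :
    D.loadErrMat ω = (N : ℝ)⁻¹ • ∑ i, vecMulVec (D.γ i) (D.errVec i ω) := by
  ext a b
  simp [loadErrMat, loadErr, errVec, Matrix.sum_apply, vecMulVec_apply]

lemma mul_vecMulVec_mul_transpose (A B : Matrix (Fac k₁ k₂) (Fac k₁ k₂) ℝ)
    (v w : Fac k₁ k₂ → ℝ) : vecMulVec (A *ᵥ v) (B *ᵥ w) = A * vecMulVec v w * Bᵀ := by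
  rw [mul_vecMulVec, vecMulVec_mul, vecMul_transpose]

lemma scaledGram_eq_sum (D : Panel k₁ k₂ N T Ω) (ω : Ω) :
    D.scaledGram ω = (N : ℝ)⁻¹ • ∑ i, vecMulVec (loadScale k₁ k₂ T *ᵥ D.betaHat i ω)
      (loadScale k₁ k₂ T *ᵥ D.betaHat i ω) := by
  simp only [mul_vecMulVec_mul_transpose, loadScale_transpose, scaledGram, gram,
    Finset.mul_sum, Finset.sum_mul]

lemma scaledGram_eq (hT : 0 < T) (hS : IsUnit (D.sampleCov ω).det)
    (hr : ∀ i t, D.r i t ω = lam ⬝ᵥ D.β i + (D.F t ω - μ) ⬝ᵥ D.β i + D.e i t ω) :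
    D.scaledGram ω = D.loadMat + D.loadErrMat ω * (errScale k₁ k₂ T * (D.sampleCov ω)⁻¹)ᵀ
      + (errScale k₁ k₂ T * (D.sampleCov ω)⁻¹) * (D.loadErrMat ω)ᵀ
      + (errScale k₁ k₂ T * (D.sampleCov ω)⁻¹) * D.errMat ω
        * (errScale k₁ k₂ T * (D.sampleCov ω)⁻¹)ᵀ := by
  set M := errScale k₁ k₂ T * (D.sampleCov ω)⁻¹ with hM
  have h : ∀ i, vecMulVec (D.γ i + M *ᵥ D.errVec i ω) (D.γ i + M *ᵥ D.errVec i ω)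
      = vecMulVec (D.γ i) (D.γ i) + vecMulVec (D.γ i) (D.errVec i ω) * Mᵀ
        + M * (vecMulVec (D.γ i) (D.errVec i ω))ᵀ
        + M * vecMulVec (D.errVec i ω) (D.errVec i ω) * Mᵀ := by
    intro i
    rw [transpose_vecMulVec, mul_vecMulVec, mul_vecMulVec, vecMulVec_mul, vecMulVec_mul,
      vecMul_transpose, add_vecMulVec, vecMulVec_add, vecMulVec_add]
    abel
  rw [scaledGram_eq_sum]
  simp only [loadScale_mulVec_betaHat hT hS hr, ← hM, h, Finset.sum_add_distrib, smul_add,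
    ← Finset.sum_mul, ← Finset.mul_sum, ← transpose_sum, loadMat, errMat_eq, loadErrMat_eq,
    transpose_smul, Matrix.smul_mul, Matrix.mul_smul]

/-- Rests on `premScale` being √T times the inverse of `loadScale`; it brings out the normalized
Gram matrix, which has an invertible limit. -/
lemma premScale_mulVec_gram_inv (hT : 0 < T) (hN : 0 < N) (ω : Ω) (z : Fac k₁ k₂ → ℝ)
    (hG : IsUnit (D.gram ω).det) :
    premScale k₁ k₂ T *ᵥ ((D.gram ω)⁻¹ *ᵥ z)
      = (D.scaledGram ω)⁻¹ *ᵥ ((N : ℝ)⁻¹ • (√(T : ℝ) • (loadScale k₁ k₂ T *ᵥ z))) := by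
  have hQ := isUnit_det_loadScale (k₁ := k₁) (k₂ := k₂) hT
  have hN' : (N : ℝ)⁻¹ ≠ 0 := inv_ne_zero (by exact_mod_cast hN.ne')
  have hinv : (D.scaledGram ω)⁻¹ = (N : ℝ) • ((loadScale k₁ k₂ T)⁻¹ * ((D.gram ω)⁻¹
      * (loadScale k₁ k₂ T)⁻¹)) := by
    have : Invertible (N : ℝ)⁻¹ := invertibleOfNonzero hN'
    rw [scaledGram, inv_smul _ _ (by
      rw [det_mul, det_mul]; exact (hQ.mul hG).mul hQ), invOf_eq_inv, inv_inv,
      Matrix.mul_inv_rev, Matrix.mul_inv_rev]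
  have hgram : premScale k₁ k₂ T = √(T : ℝ) • (loadScale k₁ k₂ T)⁻¹ := by
    rw [← mul_nonsing_inv_cancel_right _ (premScale k₁ k₂ T) hQ, premScale_mul_loadScale,
      Matrix.smul_mul, one_mul]
  rw [hinv, hgram, smul_mulVec, smul_mulVec, mulVec_smul, smul_smul, mul_inv_cancel₀
    (by exact_mod_cast hN.ne'), one_smul, mulVec_smul, mulVec_mulVec, mulVec_mulVec, mul_assoc,
    mul_assoc, nonsing_inv_mul _ hQ, mul_one]

/-- The errors-in-variables formula: substituting β̂ᵢ for βᵢ in the average return leaves the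
average error minus l' times the first-pass noise, and this residual is correlated with the
regressor β̂ᵢ. -/
lemma premScale_mulVec_lamTP_sub (hT : 0 < T) (hN : 0 < N) (hS : IsUnit (D.sampleCov ω).det)
    (hG : IsUnit (D.gram ω).det)
    (hr : ∀ i t, D.r i t ω = lam ⬝ᵥ D.β i + (D.F t ω - μ) ⬝ᵥ D.β i + D.e i t ω)
    {l : Fac k₁ k₂ → ℝ} (hl : l = lam + (T : ℝ)⁻¹ • ∑ t : Fin T, (D.F t ω - μ)) :
    premScale k₁ k₂ T *ᵥ (D.lamTP ω - l)
      = (D.scaledGram ω)⁻¹ *ᵥ ((fun a => D.loadErr a none ω)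
        + (errScale k₁ k₂ T * (D.sampleCov ω)⁻¹) *ᵥ (fun a => D.errGram (some a) none ω)
        - (D.loadErrMat ω + errScale k₁ k₂ T * (D.sampleCov ω)⁻¹ * D.errMat ω)
          *ᵥ (((D.sampleCov ω)⁻¹)ᵀ *ᵥ l)) := by
  have hT2 : √(T : ℝ) ≠ 0 := (Real.sqrt_pos.mpr (by exact_mod_cast hT)).ne'
  set A := (D.sampleCov ω)⁻¹ with hA
  set M := errScale k₁ k₂ T * A with hM
  have hgram : D.gram ω *ᵥ l = ∑ i, (D.betaHat i ω ⬝ᵥ l) • D.betaHat i ω := by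
    simp only [gram, sum_mulVec, vecMulVec_mulVec, op_smul_eq_smul]
  have hsum : ∑ i, D.avgR i ω • D.betaHat i ω = D.gram ω *ᵥ l
      + (√(T : ℝ))⁻¹ • ∑ i, (D.errAvg none i ω - D.errVec i ω ⬝ᵥ (Aᵀ *ᵥ l)) • D.betaHat i ω := by
    rw [hgram, Finset.smul_sum, ← Finset.sum_add_distrib]
    refine Finset.sum_congr rfl fun i _ => ?_
    rw [smul_smul, ← add_smul]
    congr 1
    rw [avgR_eq hT hr, ← hl, betaHat_eq hT hS hr, ← hA, add_dotProduct, smul_dotProduct,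
      mulVec_transpose, dotProduct_comm (D.errVec i ω), ← dotProduct_mulVec,
      dotProduct_comm (A *ᵥ _), dotProduct_comm l, smul_eq_mul]
    ring
  have hlam : D.lamTP ω - l = (D.gram ω)⁻¹ *ᵥ ((√(T : ℝ))⁻¹ •
      ∑ i, (D.errAvg none i ω - D.errVec i ω ⬝ᵥ (Aᵀ *ᵥ l)) • D.betaHat i ω) := by
    rw [lamTP, hsum, mulVec_add, mulVec_mulVec, nonsing_inv_mul _ hG, one_mulVec,
      add_sub_cancel_left]
  rw [hlam, premScale_mulVec_gram_inv hT hN ω _ hG]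
  congr 1
  rw [mulVec_smul, smul_smul (√(T : ℝ)), mul_inv_cancel₀ hT2, one_smul, mulVec_sum]
  have hterm : ∀ i, loadScale k₁ k₂ T *ᵥ
      ((D.errAvg none i ω - D.errVec i ω ⬝ᵥ (Aᵀ *ᵥ l)) • D.betaHat i ω)
      = D.errAvg none i ω • D.γ i + M *ᵥ (D.errAvg none i ω • D.errVec i ω)
        - (vecMulVec (D.γ i) (D.errVec i ω) *ᵥ (Aᵀ *ᵥ l)
          + M *ᵥ (vecMulVec (D.errVec i ω) (D.errVec i ω) *ᵥ (Aᵀ *ᵥ l))) := by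
    intro i
    rw [mulVec_smul, loadScale_mulVec_betaHat hT hS hr, ← hA, ← hM, sub_smul, vecMulVec_mulVec,
      vecMulVec_mulVec, op_smul_eq_smul, op_smul_eq_smul, mulVec_smul, mulVec_smul, smul_add,
      smul_add]
  have h1 : (fun a => D.loadErr a none ω) = (N : ℝ)⁻¹ • ∑ i, D.errAvg none i ω • D.γ i := by
    ext a
    simp [loadErr, Finset.sum_apply, mul_comm]
  have h2 : (fun a => D.errGram (some a) none ω)
      = (N : ℝ)⁻¹ • ∑ i, D.errAvg none i ω • D.errVec i ω := by
    ext a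
    simp [errGram, errVec, Finset.sum_apply, mul_comm]
  generalize Aᵀ *ᵥ l = y at hterm ⊢
  simp only [hterm, Finset.sum_sub_distrib, Finset.sum_add_distrib, h1, h2, errMat_eq,
    loadErrMat_eq, smul_sub, smul_add, add_mulVec, ← mulVec_mulVec, smul_mulVec, mulVec_smul,
    mulVec_sum, sum_mulVec]

lemma premScale_mulVec_attBias {mΩ : MeasurableSpace Ω} {P : Measure Ω} (hT : 0 < T) (hN : 0 < N)
    (SigF : Matrix (Fac k₁ k₂) (Fac k₁ k₂) ℝ) (hG : IsUnit (D.gram ω).det) :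
    premScale k₁ k₂ T *ᵥ D.attBias P SigF lam ω
      = -((D.scaledGram ω)⁻¹ *ᵥ (errScale k₁ k₂ T *ᵥ
        ((SigF⁻¹ * D.errMat ω * (SigF⁻¹)ᵀ) *ᵥ D.lamTilde P lam ω))) := by
  rw [attBias, mulVec_neg, premScale_mulVec_gram_inv hT hN ω _ hG, ← sqrt_inv_smul_loadScale hT]
  congr 2
  have h : ∑ i, vecMulVec (D.u SigF i ω) (D.u SigF i ω)
      = ((√(T : ℝ))⁻¹ * (√(T : ℝ))⁻¹) • ∑ i, SigF⁻¹ *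
        vecMulVec (D.errVec i ω) (D.errVec i ω) * (SigF⁻¹)ᵀ := by
    rw [Finset.smul_sum]
    refine Finset.sum_congr rfl fun i _ => ?_
    rw [u_eq D hT, smul_vecMulVec, vecMulVec_smul, mul_vecMulVec_mul_transpose, smul_smul]
  have hT2 : √(T : ℝ) ≠ 0 := (Real.sqrt_pos.mpr (by exact_mod_cast hT)).ne'
  rw [h, errMat_eq, ← Finset.sum_mul, ← Finset.mul_sum]
  simp only [Matrix.mul_smul, Matrix.smul_mul, smul_mulVec, mulVec_smul, smul_smul]
  congr 1
  field_simp

lemma premScale_mulVec (z : Fac k₁ k₂ → ℝ) :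
    premScale k₁ k₂ T *ᵥ z
      = Sum.elim (fun a => √(T : ℝ) * z (Sum.inl a)) (fun a => z (Sum.inr a)) := by
  ext a
  rw [premScale, mulVec_diagonal]
  rcases a with a | a <;> simp

end Algebra

end Panel

/-! ### Continuity of matrix operations and the limiting scale -/

lemma tendsto_matrix_inv {ι n : Type*} [Fintype n] [DecidableEq n] {l : Filter ι}
    {M : ι → Matrix n n ℝ} {A : Matrix n n ℝ} (h : Tendsto M l (𝓝 A)) (hA : A.det ≠ 0) :
    Tendsto (fun i => (M i)⁻¹) l (𝓝 A⁻¹) :=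
  (continuousAt_matrix_inv A (by
    rw [Ring.inverse_eq_inv']
    exact continuousAt_inv₀ hA)).tendsto.comp h

lemma tendsto_mulVec {ι m n : Type*} [Fintype n] {l : Filter ι} {M : ι → Matrix m n ℝ}
    {A : Matrix m n ℝ} {v : ι → n → ℝ} {w : n → ℝ} (hM : Tendsto M l (𝓝 A))
    (hv : Tendsto v l (𝓝 w)) : Tendsto (fun i => M i *ᵥ v i) l (𝓝 (A *ᵥ w)) :=
  ((continuous_fst.matrix_mulVec continuous_snd).tendsto (A, w)).comp (hM.prodMk_nhds hv)

lemma tendsto_matrix_transpose {ι m n : Type*} {l : Filter ι} {M : ι → Matrix m n ℝ}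
    {A : Matrix m n ℝ} (hM : Tendsto M l (𝓝 A)) : Tendsto (fun i => (M i)ᵀ) l (𝓝 Aᵀ) :=
  (continuous_id.matrix_transpose.tendsto A).comp hM

lemma tendsto_matrix {ι m n : Type*} {l : Filter ι} {M : ι → Matrix m n ℝ} {A : Matrix m n ℝ}
    (h : ∀ a b, Tendsto (fun i => M i a b) l (𝓝 (A a b))) : Tendsto M l (𝓝 A) :=
  tendsto_pi_nhds.mpr fun a => tendsto_pi_nhds.mpr fun b => h a b

lemma weakBlock_eq_diagonal (k₁ k₂ : ℕ) :
    weakBlock k₁ k₂ = diagonal (Sum.elim (fun _ => 0) fun _ => 1) := by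
  rw [weakBlock, ← fromBlocks_diagonal]
  simp

lemma weakBlock_transpose (k₁ k₂ : ℕ) : (weakBlock k₁ k₂)ᵀ = weakBlock k₁ k₂ := by
  rw [weakBlock_eq_diagonal, diagonal_transpose]

lemma tendsto_errScale (k₁ k₂ : ℕ) :
    Tendsto (fun T => Panel.errScale k₁ k₂ T) atTop (𝓝 (weakBlock k₁ k₂)) := by
  rw [weakBlock_eq_diagonal]
  refine (continuous_id.matrix_diagonal.tendsto _).comp (tendsto_pi_nhds.mpr ?_)
  rintro (a | a)
  · exact tendsto_sqrt_inv_atTop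
  · exact tendsto_const_nhds

/-! ### Probability limits of the Gram matrix, the estimate and the bias -/

section Limits

variable {k₁ k₂ : ℕ} {Ω : ℕ → ℕ → Type*} [∀ N T, MeasurableSpace (Ω N T)]
  {P : ∀ N T, Measure (Ω N T)} [∀ N T, IsProbabilityMeasure (P N T)]
  {D : ∀ N T, Panel k₁ k₂ N T (Ω N T)} {lam : Fac k₁ k₂ → ℝ}
  {SigF OmF Γ SigSF : Matrix (Fac k₁ k₂) (Fac k₁ k₂) ℝ}

lemma Factors.transpose_eq (hF : Factors P D SigF OmF) : SigFᵀ = SigF := by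
  ext a b
  rw [transpose_apply, ← hF.cov_eq 0 0 0 b a, ← hF.cov_eq 0 0 0 a b, covariance_comm]

lemma Factors.sigmaU_eq (hF : Factors P D SigF OmF) :
    SigF⁻¹ * SigSF * (SigF⁻¹)ᵀ = sigmaU SigF SigSF := by
  rw [transpose_nonsing_inv, hF.transpose_eq, sigmaU]

/-- Supplies the single mean μ that the finite-sample algebra uses for all periods. -/
lemma Factors.meanF_eq (hF : Factors P D SigF OmF) (N T t : ℕ) :
    (D N T).meanF (P N T) t = (D N T).meanF (P N T) 0 := by
  induction t with
  | zero => rfl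
  | succ t ih =>
    rw [← ih]
    ext a
    exact ((hF.stationary N T).comp (u := fun f : ℕ → Fac k₁ k₂ → ℝ => f t a)
      ((measurable_pi_apply a).comp (measurable_pi_apply t))).integral_eq

/-- The Gram matrix in the limit is positive definite. -/
lemma limitGram_posDef (hF : Factors P D SigF OmF) (hL : Loadings D Γ)
    (hE : Errors P D SigSF) : (limitGram Γ (sigmaU SigF SigSF)).PosDef := by
  have h1 : (sigmaU SigF SigSF).PosSemidef := by
    rw [← hF.sigmaU_eq]
    have := (hE.posSemidef hF).mul_mul_conjTranspose_same SigF⁻¹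
    rwa [conjTranspose_eq_transpose_of_trivial] at this
  have h2 := h1.mul_mul_conjTranspose_same (weakBlock k₁ k₂)
  rw [conjTranspose_eq_transpose_of_trivial, weakBlock_transpose] at h2
  exact hL.posDef.add_posSemidef h2

lemma tendsto_sampleCov (hF : Factors P D SigF OmF) :
    Tendsto (fun z : Σ p : ℕ × ℕ, Ω p.1 p.2 => (D z.1.1 z.1.2).sampleCov z.2)
      (probFilter P) (𝓝 SigF) :=
  tendsto_matrix fun a b => by
    simpa only [Panel.sampleCov, of_apply] using tendstoInProb_iff.mp (hF.sample_cov a b)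

lemma tendsto_errMat (hF : Factors P D SigF OmF) (hE : Errors P D SigSF) :
    Tendsto (fun z : Σ p : ℕ × ℕ, Ω p.1 p.2 => (D z.1.1 z.1.2).errMat z.2)
      (probFilter P) (𝓝 SigSF) :=
  tendsto_matrix fun a b => tendsto_errGram_some hF hE a b

lemma tendsto_loadErrMat (hF : Factors P D SigF OmF) (hE : Errors P D SigSF) :
    Tendsto (fun z : Σ p : ℕ × ℕ, Ω p.1 p.2 => (D z.1.1 z.1.2).loadErrMat z.2)
      (probFilter P) (𝓝 0) :=
  tendsto_matrix fun a b => tendsto_loadErr hF hE a (some b)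

/-- With probability approaching one, the factor-pricing model holds in the whole sample, and the
sample covariance matrix of the factors is invertible. -/
lemma eventually_regular (hM : ∀ N T, (D N T).PricingModel (P N T) lam)
    (hF : Factors P D SigF OmF) :
    ∀ᶠ z : Σ p : ℕ × ℕ, Ω p.1 p.2 in probFilter P, 0 < z.1.1 ∧ 0 < z.1.2 ∧
      IsUnit ((D z.1.1 z.1.2).sampleCov z.2).det ∧
      ∀ i t, (D z.1.1 z.1.2).r i t z.2 = lam ⬝ᵥ (D z.1.1 z.1.2).β i
        + ((D z.1.1 z.1.2).F t z.2 - (D z.1.1 z.1.2).meanF (P z.1.1 z.1.2) 0)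
          ⬝ᵥ (D z.1.1 z.1.2).β i + (D z.1.1 z.1.2).e i t z.2 := by
  have h1 : ∀ᶠ z : Σ p : ℕ × ℕ, Ω p.1 p.2 in probFilter P,
      ∀ i t, (D z.1.1 z.1.2).r i t z.2 = lam ⬝ᵥ (D z.1.1 z.1.2).β i
        + ((D z.1.1 z.1.2).F t z.2 - (D z.1.1 z.1.2).meanF (P z.1.1 z.1.2) 0)
          ⬝ᵥ (D z.1.1 z.1.2).β i + (D z.1.1 z.1.2).e i t z.2 := by
    refine eventually_probFilter_of_ae fun p => ?_
    have h := ae_all_iff.mpr fun i => ae_all_iff.mpr fun t => hM p.1 p.2 i t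
    filter_upwards [h] with ω h i t
    rw [h, hF.meanF_eq]
  have h2 : ∀ᶠ z : Σ p : ℕ × ℕ, Ω p.1 p.2 in probFilter P,
      ((D z.1.1 z.1.2).sampleCov z.2).det ≠ 0 :=
    ((continuous_id.matrix_det.tendsto SigF).comp (tendsto_sampleCov hF)).eventually_ne
      hF.full_rank
  filter_upwards [h1, h2, (tendsto_N_probFilter P).eventually (eventually_gt_atTop 0),
    (tendsto_T_probFilter P).eventually (eventually_gt_atTop 0)] with z hz1 hz2 hz3 hz4
  exact ⟨hz3, hz4, isUnit_iff_ne_zero.mpr hz2, hz1⟩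

lemma tendsto_errScale_mul (hF : Factors P D SigF OmF) :
    Tendsto (fun z : Σ p : ℕ × ℕ, Ω p.1 p.2 =>
      Panel.errScale k₁ k₂ z.1.2 * ((D z.1.1 z.1.2).sampleCov z.2)⁻¹)
      (probFilter P) (𝓝 (weakBlock k₁ k₂ * SigF⁻¹)) :=
  ((tendsto_errScale k₁ k₂).comp (tendsto_T_probFilter P)).mul
    (tendsto_matrix_inv (tendsto_sampleCov hF) hF.full_rank)

/-- Both cross terms vanish and the noise term keeps only its weak-weak block, since `errScale`
tends to `weakBlock`. -/
lemma tendsto_scaledGram (hM : ∀ N T, (D N T).PricingModel (P N T) lam)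
    (hF : Factors P D SigF OmF) (hL : Loadings D Γ) (hE : Errors P D SigSF) :
    Tendsto (fun z : Σ p : ℕ × ℕ, Ω p.1 p.2 => (D z.1.1 z.1.2).scaledGram z.2)
      (probFilter P) (𝓝 (limitGram Γ (sigmaU SigF SigSF))) := by
  have hA := tendsto_errScale_mul hF
  have hA' := tendsto_matrix_transpose hA
  have hH := tendsto_loadErrMat hF hE
  have h := (((hL.tendsto.comp (tendsto_fst_probFilter P)).add (hH.mul hA')).add
    (hA.mul (tendsto_matrix_transpose hH))).add ((hA.mul (tendsto_errMat hF hE)).mul hA')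
  have hlim : Γ + 0 * (weakBlock k₁ k₂ * SigF⁻¹)ᵀ + weakBlock k₁ k₂ * SigF⁻¹ * 0ᵀ
      + weakBlock k₁ k₂ * SigF⁻¹ * SigSF * (weakBlock k₁ k₂ * SigF⁻¹)ᵀ
      = limitGram Γ (sigmaU SigF SigSF) := by
    rw [zero_mul, transpose_zero, mul_zero, add_zero, add_zero, limitGram, ← hF.sigmaU_eq,
      transpose_mul, weakBlock_transpose]
    simp only [Matrix.mul_assoc]
  rw [hlim] at h
  refine h.congr' ?_
  filter_upwards [eventually_regular hM hF] with z ⟨_, hT, hS, hr⟩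
  exact (Panel.scaledGram_eq hT hS hr).symm

lemma eventually_isUnit_det_gram (hM : ∀ N T, (D N T).PricingModel (P N T) lam)
    (hF : Factors P D SigF OmF) (hL : Loadings D Γ) (hE : Errors P D SigSF) :
    ∀ᶠ z : Σ p : ℕ × ℕ, Ω p.1 p.2 in probFilter P, IsUnit ((D z.1.1 z.1.2).gram z.2).det := by
  have h := ((continuous_id.matrix_det.tendsto _).comp
    (tendsto_scaledGram hM hF hL hE)).eventually_ne (limitGram_posDef hF hL hE).det_pos.ne'
  filter_upwards [h] with z hz
  rw [isUnit_iff_ne_zero]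
  intro h0
  refine hz ?_
  simp [Panel.scaledGram, det_mul, h0]

lemma limitBias_eq (hF : Factors P D SigF OmF) (lam : Fac k₁ k₂ → ℝ) :
    limitBias Γ (sigmaU SigF SigSF) lam = -((limitGram Γ (sigmaU SigF SigSF))⁻¹ *ᵥ
      (weakBlock k₁ k₂ *ᵥ ((SigF⁻¹ * SigSF * (SigF⁻¹)ᵀ) *ᵥ lam))) := by
  rw [hF.sigmaU_eq, limitBias]

/-- The probability limit of the normalized attenuation bias. -/
lemma tendsto_premScale_attBias (hM : ∀ N T, (D N T).PricingModel (P N T) lam)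
    (hF : Factors P D SigF OmF) (hL : Loadings D Γ) (hE : Errors P D SigSF) :
    Tendsto (fun z : Σ p : ℕ × ℕ, Ω p.1 p.2 => Panel.premScale k₁ k₂ z.1.2 *ᵥ
        (D z.1.1 z.1.2).attBias (P z.1.1 z.1.2) SigF lam z.2)
      (probFilter P) (𝓝 (limitBias Γ (sigmaU SigF SigSF) lam)) := by
  have hV := ((tendsto_errMat hF hE).const_mul SigF⁻¹).mul_const (SigF⁻¹)ᵀ
  have h := (tendsto_mulVec (tendsto_matrix_inv (tendsto_scaledGram hM hF hL hE)
    (limitGram_posDef hF hL hE).det_pos.ne') (tendsto_mulVec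
      ((tendsto_errScale k₁ k₂).comp (tendsto_T_probFilter P))
      (tendsto_mulVec hV (tendsto_lamTilde hF lam)))).neg
  rw [limitBias_eq hF]
  refine h.congr' ?_
  filter_upwards [eventually_regular hM hF, eventually_isUnit_det_gram hM hF hL hE]
    with z ⟨hN, hT, _, _⟩ hG
  exact (Panel.premScale_mulVec_attBias hT hN SigF hG).symm

/-- The normalized deviation of the two-pass estimate from the ex-post risk premia has the same
probability limit as the normalized attenuation bias. -/
lemma tendsto_premScale_lamTP_sub (hM : ∀ N T, (D N T).PricingModel (P N T) lam)
    (hF : Factors P D SigF OmF) (hL : Loadings D Γ) (hE : Errors P D SigSF) :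
    Tendsto (fun z : Σ p : ℕ × ℕ, Ω p.1 p.2 => Panel.premScale k₁ k₂ z.1.2 *ᵥ
        ((D z.1.1 z.1.2).lamTP z.2 - (D z.1.1 z.1.2).lamTilde (P z.1.1 z.1.2) lam z.2))
      (probFilter P) (𝓝 (limitBias Γ (sigmaU SigF SigSF) lam)) := by
  have hA := tendsto_errScale_mul hF
  have hB := tendsto_matrix_transpose (tendsto_matrix_inv (tendsto_sampleCov hF) hF.full_rank)
  have hh : Tendsto (fun (z : Σ p : ℕ × ℕ, Ω p.1 p.2) a => (D z.1.1 z.1.2).loadErr a none z.2)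
      (probFilter P) (𝓝 0) := tendsto_pi_nhds.mpr fun a => tendsto_loadErr hF hE a none
  have hg : Tendsto (fun (z : Σ p : ℕ × ℕ, Ω p.1 p.2) a =>
      (D z.1.1 z.1.2).errGram (some a) none z.2) (probFilter P) (𝓝 0) :=
    tendsto_pi_nhds.mpr fun a => tendsto_errGram_none hF hE a
  have h := tendsto_mulVec (tendsto_matrix_inv (tendsto_scaledGram hM hF hL hE)
    (limitGram_posDef hF hL hE).det_pos.ne') ((hh.add (tendsto_mulVec hA hg)).sub
      (tendsto_mulVec ((tendsto_loadErrMat hF hE).add (hA.mul (tendsto_errMat hF hE)))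
        (tendsto_mulVec hB (tendsto_lamTilde hF lam))))
  -- Only the noise-with-noise term has a nonzero limit; regrouping it identifies the limit of the
  -- attenuation bias.
  rw [zero_add, mulVec_zero, zero_sub, zero_add, mulVec_neg, mulVec_mulVec (M := _ * SigSF),
    Matrix.mul_assoc, Matrix.mul_assoc, ← mulVec_mulVec (M := weakBlock k₁ k₂), ← Matrix.mul_assoc,
    ← limitBias_eq hF] at h
  refine h.congr' ?_
  filter_upwards [eventually_regular hM hF, eventually_isUnit_det_gram hM hF hL hE]
    with z ⟨hN, hT, hS, hr⟩ hG
  refine (Panel.premScale_mulVec_lamTP_sub hT hN hS hG hr ?_).symm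
  simp only [Panel.lamTilde, hF.meanF_eq]

end Limits

end TwoPass

end

/-! ### The expansions and the limiting bias -/

theorem corollary2 {k₁ k₂ : ℕ} (hk₂ : 1 ≤ k₂)
    {Ω : ℕ → ℕ → Type*} [∀ N T, MeasurableSpace (Ω N T)]
    (P : ∀ N T, Measure (Ω N T)) [∀ N T, IsProbabilityMeasure (P N T)]
    (D : ∀ N T, TwoPass.Panel k₁ k₂ N T (Ω N T))
    (lam : TwoPass.Fac k₁ k₂ → ℝ)
    (SigF OmF Γ SigSF : Matrix (TwoPass.Fac k₁ k₂) (TwoPass.Fac k₁ k₂) ℝ)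
    (hmodel : ∀ N T, (D N T).PricingModel (P N T) lam)
    (hfactors : TwoPass.Factors P D SigF OmF)
    (hloadings : TwoPass.Loadings D Γ)
    (herrors : TwoPass.Errors P D SigSF) :
    TwoPass.TendstoInProb P
      (fun N T ω (a : Fin k₁) =>
        √(T : ℝ) * ((D N T).lamTP ω (Sum.inl a) - lam (Sum.inl a))
          - (√(T : ℝ) * ((D N T).lamTilde (P N T) lam ω (Sum.inl a) - lam (Sum.inl a))
            + √(T : ℝ) * (D N T).attBias (P N T) SigF lam ω (Sum.inl a))) 0 ∧
    TwoPass.TendstoInProb P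
      (fun N T ω (a : Fin k₂) =>
        (D N T).lamTP ω (Sum.inr a) - lam (Sum.inr a)
          - (D N T).attBias (P N T) SigF lam ω (Sum.inr a)) 0 ∧
    IsUnit (TwoPass.limitGram Γ (TwoPass.sigmaU SigF SigSF)).det ∧
    TwoPass.TendstoInProb P
      (fun N T ω => Sum.elim
        (fun a : Fin k₁ => √(T : ℝ) * (D N T).attBias (P N T) SigF lam ω (Sum.inl a))
        (fun a : Fin k₂ => (D N T).attBias (P N T) SigF lam ω (Sum.inr a)))
      (TwoPass.limitBias Γ (TwoPass.sigmaU SigF SigSF) lam) ∧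
    (TwoPass.weakBlock k₁ k₂ *ᵥ (TwoPass.sigmaU SigF SigSF *ᵥ lam) ≠ 0 →
      TwoPass.limitBias Γ (TwoPass.sigmaU SigF SigSF) lam ≠ 0) := by
  have hY := TwoPass.tendsto_premScale_lamTP_sub hmodel hfactors hloadings herrors
  have hZ := TwoPass.tendsto_premScale_attBias hmodel hfactors hloadings herrors
  -- Equality of the two limits makes the remainder of the expansions o_p(1) in both blocks at once.
  have hYZ := hY.sub hZ
  rw [sub_self] at hYZ
  have hpos := TwoPass.limitGram_posDef hfactors hloadings herrors
  have hunit : IsUnit (TwoPass.limitGram Γ (TwoPass.sigmaU SigF SigSF)).det :=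
    isUnit_iff_ne_zero.mpr hpos.det_pos.ne'
  refine ⟨?_, ?_, hunit, ?_, ?_⟩
  · rw [TwoPass.tendstoInProb_iff, tendsto_pi_nhds]
    intro a
    refine (tendsto_pi_nhds.mp hYZ (Sum.inl a)).congr fun z => ?_
    simp only [TwoPass.Panel.premScale_mulVec, Pi.sub_apply, Sum.elim_inl]
    ring
  · rw [TwoPass.tendstoInProb_iff, tendsto_pi_nhds]
    intro a
    -- The weak block is not scaled by √T, so λ̃ - λ is negligible there and is absorbed into the
    -- remainder.
    have hl := tendsto_pi_nhds.mp (TwoPass.tendsto_lamTilde hfactors lam) (Sum.inr a)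
    have h := (tendsto_pi_nhds.mp hYZ (Sum.inr a)).add (hl.sub_const (lam (Sum.inr a)))
    rw [sub_self, Pi.zero_apply, add_zero] at h
    refine h.congr fun z => ?_
    simp only [TwoPass.Panel.premScale_mulVec, Pi.sub_apply, Sum.elim_inr]
    ring
  · rw [TwoPass.tendstoInProb_iff]
    exact hZ.congr fun z => TwoPass.Panel.premScale_mulVec _
  · intro hne h0
    refine hne ?_
    rw [TwoPass.limitBias, neg_eq_zero] at h0
    have h1 := congrArg (TwoPass.limitGram Γ (TwoPass.sigmaU SigF SigSF) *ᵥ ·) h0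
    simpa only [mulVec_mulVec, mul_nonsing_inv_cancel_left _ _ hunit, mulVec_zero] using h1
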